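/- For integers $n\ge 1$ and $d,e,m\ge 0$, let $\mathcal{T}^n_{d,e,m}$ (the Taylor variety) be the Zariski closure in the complex projective space $\mathbb{P}^{\binom{n+m}{n}-1}$ of polynomials $\sum_{|\gamma|\le m}c_\gamma x^\gamma$ in $n$ variables of degree $\le m$ (up to scaling) of the set of all Taylor polynomials of degree $\le m$ at the origin of rational functions $P/Q$, where $P,Q\in\mathbb{C}[x_1,\dots,x_n]$, $\deg P\le d$, $\deg Q\le e$ and $P(0)=Q(0)=1$. The expected dimension of $\mathcal{T}^n_{d,e,m}$ is $$\min\Bigl\{\tbinom{d+n}{n}+\tbinom{e+n}{n}-2,\ \tbinom{m+n}{n}-1\Bigr\}.$$ **Proposition 4.1.** (1) The Taylor variety $\mathcal{T}^3_{2,2,3}\subset\mathbb{P}^{19}$ has expected dimension $18$ (so it is expected to be a hypersurface), but its dimension is $17$, i.e. it has codimension two. (2) The Taylor variety $\mathcal{T}^3_{8,5,9}\subset\mathbb{P}^{219}$ has expected dimension $219$ (so it is expected to fill its ambient space), but its dimension is $218$ and it is a hypersurface, i.e. the zero set of one irreducible homogeneous polynomial. The same holds for $\mathcal{T}^3_{5,8,9}\subset\mathbb{P}^{219}$.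 -/

import Mathlib

noncomputable section

/-- The exponents `γ` of the monomials of total degree at most `m` in `n` variables. -/
abbrev TaylorIndex (n m : ℕ) : Type := {γ : Fin n →₀ ℕ // γ.degree ≤ m}

/-- The projective space over `ℂ` with homogeneous coordinates indexed by `σ`,
as a set of points (lines through the origin in `σ → ℂ`). It carries the Zariski topology below. -/
def ProjSpace (σ : Type) : Type := Projectivization ℂ (σ → ℂ)

namespace ProjSpace

variable {σ : Type}

/-- The common zeros in projective space of a set of polynomials. It is only used for homogeneous
polynomials, whose vanishing at a point does not depend on the chosen representative. -/
def zeroLocus (S : Set (MvPolynomial σ ℂ)) : Set (ProjSpace σ) :=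
  {x | ∀ f ∈ S, MvPolynomial.eval (Projectivization.rep x) f = 0}

/-- The homogeneous polynomials, of any degree. -/
def homogeneousPolys (σ : Type) : Set (MvPolynomial σ ℂ) :=
  {f | ∃ k : ℕ, f.IsHomogeneous k}

/-- The Zariski topology: the closed sets are the common zero sets of homogeneous polynomials. -/
instance zariskiTopology : TopologicalSpace (ProjSpace σ) :=
  TopologicalSpace.ofClosed
    {Z | ∃ S : Set (MvPolynomial σ ℂ), S ⊆ homogeneousPolys σ ∧ Z = zeroLocus S}
    (by
      refine ⟨{1}, ?_, ?_⟩
      · rintro f rfl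
        exact ⟨0, MvPolynomial.isHomogeneous_one σ ℂ⟩
      · ext x
        simp [zeroLocus])
    (by
      intro A hA
      refine ⟨{f | f ∈ homogeneousPolys σ ∧ ∃ Z ∈ A, ∀ x ∈ Z,
        MvPolynomial.eval (Projectivization.rep x) f = 0}, fun f hf => hf.1, ?_⟩
      ext x
      constructor
      · rintro hx f ⟨-, Z, hZ, h⟩
        exact h x (hx Z hZ)
      · intro hx Z hZ
        obtain ⟨S, hS, rfl⟩ := hA hZ
        intro f hf
        exact hx f ⟨hS hf, _, hZ, fun y hy => hy f hf⟩)
    (by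
      rintro _ ⟨S, hS, rfl⟩ _ ⟨T, hT, rfl⟩
      refine ⟨{h | ∃ f ∈ S, ∃ g ∈ T, h = f * g}, ?_, ?_⟩
      · rintro _ ⟨f, hf, g, hg, rfl⟩
        obtain ⟨k, hk⟩ := hS hf
        obtain ⟨l, hl⟩ := hT hg
        exact ⟨k + l, hk.mul hl⟩
      · ext x
        constructor
        · rintro (hx | hx) _ ⟨f, hf, g, hg, rfl⟩
          · simp [hx f hf]
          · simp [hx g hg]
        · intro hx
          by_contra hcon
          simp only [Set.mem_union, zeroLocus, Set.mem_ofPred_eq, not_or, not_forall] at hcon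
          obtain ⟨⟨f, hf, hf0⟩, ⟨g, hg, hg0⟩⟩ := hcon
          have := hx (f * g) ⟨f, hf, g, hg, rfl⟩
          rw [map_mul] at this
          exact (mul_ne_zero hf0 hg0) this)

/-- A subset of projective space is an (irreducible) hypersurface if it is the zero set of a single
irreducible homogeneous polynomial. -/
def IsHypersurface (X : Set (ProjSpace σ)) : Prop :=
  ∃ f : MvPolynomial σ ℂ, Irreducible f ∧ (∃ k : ℕ, f.IsHomogeneous k) ∧ X = zeroLocus {f}

end ProjSpace

/-- The coefficients `c_γ`, `|γ| ≤ m`, of the Taylor series at the origin of the rational function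
`P / Q`; the quotient is formed in the ring of formal power series and is meaningful when
`Q(0) ≠ 0`. -/
def taylorCoeffs {n : ℕ} (m : ℕ) (P Q : MvPolynomial (Fin n) ℂ) : TaylorIndex n m → ℂ :=
  fun γ => MvPowerSeries.coeff γ.1 ((P : MvPowerSeries (Fin n) ℂ) * (Q : MvPowerSeries (Fin n) ℂ)⁻¹)

/-- The points of projective space given by the Taylor polynomials of degree at most `m` of the
rational functions `P / Q` with `deg P ≤ d`, `deg Q ≤ e` and `P(0) = Q(0) = 1`. (The coefficient
vector is never zero, since its entry at `γ = 0` is `1`.) -/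
def taylorPoints (n d e m : ℕ) : Set (ProjSpace (TaylorIndex n m)) :=
  {x | ∃ P Q : MvPolynomial (Fin n) ℂ, P.totalDegree ≤ d ∧ Q.totalDegree ≤ e ∧
    MvPolynomial.constantCoeff P = 1 ∧ MvPolynomial.constantCoeff Q = 1 ∧
    ∃ h : taylorCoeffs m P Q ≠ 0, x = Projectivization.mk ℂ (taylorCoeffs m P Q) h}

/-- The Taylor variety: the Zariski closure of the set of Taylor polynomials. -/
def taylorVariety (n d e m : ℕ) : Set (ProjSpace (TaylorIndex n m)) :=
  closure (taylorPoints n d e m)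

/-- The expected dimension of the Taylor variety, from the parameter count. -/
def expectedDim (n d e m : ℕ) : ℕ :=
  min ((d + n).choose n + (e + n).choose n - 2) ((m + n).choose n - 1)

end

/-! ### Zariski topology of projective space: irreducibility, vanishing ideals, dimension,
hypersurfaces. -/

section

open MvPolynomial

/-! Take truncation degree `m = d + 1`. A truncated series `F` with constant term one is the Taylor
polynomial of some `P / Q` exactly when `Q * F` has no part of degree `d + 1`. Writing `Q = 1 - ∑
q_k x^k`, this says that the top part of `F` is a combination of the columns "degree `d + 1` part of
`x^k F`", `1 ≤ |k| ≤ e`. Since `|k| ≥ 1`, these columns involve only the coefficients of `F` of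
degree at most `d`. The Taylor points thus form a family of linear spaces over the affine space of
coefficients of degrees `1, …, d` (`TaylorIndex.total_family_eq`), of dimension the number of those
coefficients plus the generic rank of the columns.

The defect is a forced relation when `d = 2a` and `e = a + 1`, which covers `(2, 2, 3)` and `(8, 5,
9)`. With `F_j` the part of degree `j`, the product `(F_a - F_{a+1}) F` has degree `2a + 1` part
`F_a F_{a+1} - F_{a+1} F_a = 0`, so the columns are always dependent
(`TaylorIndex.finrank_span_col_lt`). Explicit series show that only one rank is lost: rank 8 in a
fibre of dimension 10, rank 54 in a fibre of dimension 55. This gives the dimensions 9 + 8 = 17 and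
164 + 54 = 218.

Dimensions are heights in the poset of irreducible closed sets. Freeing one parameter at a time
bounds the height from below; from above, one strict inclusion (codimension one) or two (codimension
two) lead up to the ambient space, whose dimension is bounded by that of the polynomial ring.
Strictness comes from a determinant that vanishes on the family but not at a chosen point
(`LinearFamily.mk_notMem_totalClosure`). A closed irreducible set of codimension one is then a
hypersurface by primality and the Nullstellensatz.

For `(5, 8, 9)`, truncated inversion of series is a polynomial involution of the chart with constant
term one. It exchanges `P / Q` and `Q / P`, so all arguments are carried out for the image of the
family under an arbitrary such involution. -/

theorem MvPolynomial.IsHomogeneous.eval_smul {σ : Type*} {R : Type*} [CommSemiring R]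
    {f : MvPolynomial σ R} {k : ℕ} (hf : f.IsHomogeneous k) (c : R) (v : σ → R) :
    eval (c • v) f = c ^ k * eval v f := by
  rw [eval_eq, eval_eq, Finset.mul_sum]
  refine Finset.sum_congr rfl fun d hd => ?_
  have h : ∑ i ∈ d.support, d i = k := (hf.degree_eq_sum_deg_support hd).symm
  simp only [Pi.smul_apply, smul_eq_mul, mul_pow, Finset.prod_mul_distrib, Finset.prod_pow_eq_pow_sum,
    h]
  ring

/-- Multiply each homogeneous component by a power of the variable `o`, so as to make the
polynomial homogeneous. -/
noncomputable def MvPolynomial.homogenizeAt {σ R : Type*} [CommSemiring R] (o : σ)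
    (p : MvPolynomial σ R) : MvPolynomial σ R :=
  ∑ i ∈ Finset.range (p.totalDegree + 1), homogeneousComponent i p * X o ^ (p.totalDegree - i)

theorem MvPolynomial.isHomogeneous_homogenizeAt {σ R : Type*} [CommSemiring R] (o : σ)
    (p : MvPolynomial σ R) : (p.homogenizeAt o).IsHomogeneous p.totalDegree := by
  refine IsHomogeneous.sum _ _ _ fun i hi => ?_
  have h := (homogeneousComponent_isHomogeneous i p).mul (isHomogeneous_X_pow (R := R) o
    (p.totalDegree - i))
  rwa [Nat.add_sub_cancel' (Nat.lt_succ_iff.1 (Finset.mem_range.1 hi))] at h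

theorem MvPolynomial.eval_homogenizeAt {σ R : Type*} [CommSemiring R] {o : σ} {v : σ → R}
    (hv : v o = 1) (p : MvPolynomial σ R) : eval v (p.homogenizeAt o) = eval v p := by
  conv_rhs => rw [← sum_homogeneousComponent p]
  simp [homogenizeAt, hv]

namespace ProjSpace

variable {σ : Type}

theorem isClosed_iff {Z : Set (ProjSpace σ)} :
    IsClosed Z ↔ ∃ S : Set (MvPolynomial σ ℂ), S ⊆ homogeneousPolys σ ∧ Z = zeroLocus S := by
  rw [← isOpen_compl_iff]
  change Zᶜᶜ ∈ _ ↔ _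
  rw [compl_compl]
  rfl

theorem isClosed_zeroLocus_singleton {f : MvPolynomial σ ℂ} {k : ℕ} (hf : f.IsHomogeneous k) :
    IsClosed (zeroLocus {f}) :=
  isClosed_iff.2 ⟨{f}, by rintro _ rfl; exact ⟨k, hf⟩, rfl⟩

theorem mem_zeroLocus_singleton {f : MvPolynomial σ ℂ} {x : ProjSpace σ} :
    x ∈ zeroLocus {f} ↔ eval (Projectivization.rep x) f = 0 := by
  simp [zeroLocus]

/-- The point of projective space represented by a nonzero vector. -/
noncomputable def mk (v : σ → ℂ) (hv : v ≠ 0) : ProjSpace σ := Projectivization.mk ℂ v hv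

theorem mk_mem_zeroLocus_singleton {f : MvPolynomial σ ℂ} {k : ℕ} (hf : f.IsHomogeneous k)
    {v : σ → ℂ} (hv : v ≠ 0) :
    mk v hv ∈ zeroLocus {f} ↔ eval v f = 0 := by
  obtain ⟨a, ha⟩ := Projectivization.exists_smul_eq_mk_rep ℂ v hv
  rw [mem_zeroLocus_singleton]
  change eval (Projectivization.mk ℂ v hv).rep f = 0 ↔ _
  rw [← ha]
  change eval ((a : ℂ) • v) f = 0 ↔ _
  rw [hf.eval_smul]
  simp

theorem exists_separating_of_notMem {Z : Set (ProjSpace σ)} (hZ : IsClosed Z) {x : ProjSpace σ}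
    (hx : x ∉ Z) : ∃ (f : MvPolynomial σ ℂ) (k : ℕ), f.IsHomogeneous k ∧ Z ⊆ zeroLocus {f} ∧
      x ∉ zeroLocus {f} := by
  obtain ⟨S, hS, rfl⟩ := isClosed_iff.1 hZ
  have : ∃ f ∈ S, eval (Projectivization.rep x) f ≠ 0 := by
    by_contra! h
    exact hx h
  obtain ⟨f, hf, hfx⟩ := this
  obtain ⟨k, hk⟩ := hS hf
  exact ⟨f, k, hk, fun y hy => mem_zeroLocus_singleton.2 (hy f hf),
    fun h => hfx (mem_zeroLocus_singleton.1 h)⟩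

/-- The points of projective space represented by the nonzero vectors of a set. -/
def ofVectors (S : Set (σ → ℂ)) : Set (ProjSpace σ) :=
  {x | ∃ v ∈ S, ∃ h : v ≠ 0, x = mk v h}

theorem ofVectors_mono {S T : Set (σ → ℂ)} (h : S ⊆ T) : ofVectors S ⊆ ofVectors T :=
  fun _ ⟨v, hv, hx⟩ => ⟨v, h hv, hx⟩

theorem mk_mem_ofVectors {S : Set (σ → ℂ)} {v : σ → ℂ} (hv : v ∈ S) (h0 : v ≠ 0) :
    mk v h0 ∈ ofVectors S :=
  ⟨v, hv, h0, rfl⟩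

/-- A polynomial that vanishes on a subset of an affine chart, but not at a further point of the
chart, separates that point from the Zariski closure of the subset. -/
theorem mk_notMem_closure_ofVectors {o : σ} {S : Set (σ → ℂ)} (hS : ∀ v ∈ S, v o = 1)
    {p : MvPolynomial σ ℂ} (hp : ∀ v ∈ S, eval v p = 0) {w : σ → ℂ} (hw : w o = 1)
    (hpw : eval w p ≠ 0) (h0 : w ≠ 0) :
    mk w h0 ∉ closure (ofVectors S) := by
  have hh := isHomogeneous_homogenizeAt o p
  intro hmem
  have hsub : closure (ofVectors S) ⊆ zeroLocus {p.homogenizeAt o} := by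
    refine closure_minimal ?_ (isClosed_zeroLocus_singleton hh)
    rintro _ ⟨v, hv, hv0, rfl⟩
    rw [mk_mem_zeroLocus_singleton hh, eval_homogenizeAt (hS v hv)]
    exact hp v hv
  have := hsub hmem
  rw [mk_mem_zeroLocus_singleton hh, eval_homogenizeAt hw] at this
  exact hpw this

/-- Forms pull back along a polynomial parametrization to polynomials on affine space. If two closed
sets cover the image, the pullbacks of their separating forms have a product vanishing everywhere,
and the polynomial ring is a domain. -/
theorem isIrreducible_closure_ofVectors_range {ι : Type*} {F : (ι → ℂ) → σ → ℂ}
    (hF : ∀ s, ∃ p : MvPolynomial ι ℂ, ∀ a, F a s = eval a p) (h0 : ∀ a, F a ≠ 0) :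
    IsIrreducible (closure (ofVectors (Set.range F))) := by
  choose P hP using hF
  refine IsIrreducible.closure ⟨⟨_, mk_mem_ofVectors (Set.mem_range_self 0) (h0 0)⟩, ?_⟩
  rw [isPreirreducible_iff_isClosed_union_isClosed]
  intro Z₁ Z₂ hZ₁ hZ₂ hsub
  by_contra! hcon
  rw [Set.not_subset, Set.not_subset] at hcon
  obtain ⟨⟨x, hx, hxZ⟩, y, hy, hyZ⟩ := hcon
  obtain ⟨f, k, hf, hZf, hxf⟩ := exists_separating_of_notMem hZ₁ hxZ
  obtain ⟨g, l, hg, hZg, hyg⟩ := exists_separating_of_notMem hZ₂ hyZ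
  obtain ⟨_, ⟨a, rfl⟩, ha, rfl⟩ := hx
  obtain ⟨_, ⟨b, rfl⟩, hb, rfl⟩ := hy
  rw [mk_mem_zeroLocus_singleton hf] at hxf
  rw [mk_mem_zeroLocus_singleton hg] at hyg
  have key : ∀ (h : MvPolynomial σ ℂ) c, eval (F c) h = eval c (bind₁ P h) := by
    intro h c
    have hFc : F c = fun s => eval c (P s) := funext fun s => hP s c
    rw [← aeval_eq_eval, ← aeval_eq_eval, aeval_bind₁, hFc]
    rfl
  have hprod : bind₁ P f * bind₁ P g = 0 := by
    refine MvPolynomial.funext fun c => ?_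
    rw [map_mul, map_zero, ← key, ← key, mul_eq_zero]
    rcases hsub (mk_mem_ofVectors (Set.mem_range_self c) (h0 c)) with h | h
    · exact Or.inl ((mk_mem_zeroLocus_singleton hf _).1 (hZf h))
    · exact Or.inr ((mk_mem_zeroLocus_singleton hg _).1 (hZg h))
  rcases mul_eq_zero.1 hprod with h | h
  · exact hxf (by rw [key, h, map_zero])
  · exact hyg (by rw [key, h, map_zero])

/-- The ideal generated by the homogeneous polynomials that vanish on a set. -/
noncomputable def homogeneousVanishingIdeal (Z : Set (ProjSpace σ)) : Ideal (MvPolynomial σ ℂ) :=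
  Ideal.span {f | f ∈ homogeneousPolys σ ∧ Z ⊆ zeroLocus {f}}

theorem eval_rep_of_mem_homogeneousVanishingIdeal {Z : Set (ProjSpace σ)} {f : MvPolynomial σ ℂ}
    (hf : f ∈ homogeneousVanishingIdeal Z) {x : ProjSpace σ} (hx : x ∈ Z) :
    eval (Projectivization.rep x) f = 0 := by
  have : homogeneousVanishingIdeal Z ≤ RingHom.ker (eval (Projectivization.rep x)) :=
    Ideal.span_le.2 fun g hg => mem_zeroLocus_singleton.1 (hg.2 hx)
  exact this hf

theorem mem_homogeneousVanishingIdeal {Z : Set (ProjSpace σ)} {f : MvPolynomial σ ℂ} {k : ℕ}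
    (hf : f.IsHomogeneous k) : f ∈ homogeneousVanishingIdeal Z ↔ Z ⊆ zeroLocus {f} :=
  ⟨fun h _ hx => mem_zeroLocus_singleton.2 (eval_rep_of_mem_homogeneousVanishingIdeal h hx),
    fun h => Ideal.subset_span ⟨⟨k, hf⟩, h⟩⟩

attribute [local instance] MvPolynomial.gradedAlgebra

theorem isHomogeneous_homogeneousVanishingIdeal (Z : Set (ProjSpace σ)) :
    (homogeneousVanishingIdeal Z).IsHomogeneous (homogeneousSubmodule σ ℂ) :=
  Ideal.homogeneous_span _ _ fun _ hf => hf.1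

theorem isPrime_homogeneousVanishingIdeal {Z : Set (ProjSpace σ)} (hZ : IsIrreducible Z) :
    (homogeneousVanishingIdeal Z).IsPrime := by
  refine (isHomogeneous_homogeneousVanishingIdeal Z).isPrime_of_homogeneous_mem_or_mem ?_ ?_
  · obtain ⟨x, hx⟩ := hZ.nonempty
    intro h
    have h1 : (1 : MvPolynomial σ ℂ) ∈ homogeneousVanishingIdeal Z := h ▸ Submodule.mem_top
    simpa using eval_rep_of_mem_homogeneousVanishingIdeal h1 hx
  · rintro f g ⟨k, hf⟩ ⟨l, hg⟩ hfg
    rw [mem_homogeneousSubmodule] at hf hg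
    rw [mem_homogeneousVanishingIdeal (hf.mul hg)] at hfg
    rw [mem_homogeneousVanishingIdeal hf, mem_homogeneousVanishingIdeal hg]
    refine isPreirreducible_iff_isClosed_union_isClosed.1 hZ.isPreirreducible _ _
      (isClosed_zeroLocus_singleton hf) (isClosed_zeroLocus_singleton hg) fun x hx => ?_
    have := mem_zeroLocus_singleton.1 (hfg hx)
    rw [map_mul, mul_eq_zero] at this
    exact this.imp mem_zeroLocus_singleton.2 mem_zeroLocus_singleton.2

theorem homogeneousVanishingIdeal_strictAnti {Z W : Set (ProjSpace σ)} (hZ : IsClosed Z)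
    (h : Z ⊂ W) : homogeneousVanishingIdeal W < homogeneousVanishingIdeal Z := by
  obtain ⟨x, hxW, hxZ⟩ := Set.exists_of_ssubset h
  obtain ⟨f, k, hf, hZf, hxf⟩ := exists_separating_of_notMem hZ hxZ
  refine lt_of_le_of_ne (Ideal.span_mono fun g hg => ⟨hg.1, h.1.trans hg.2⟩) fun heq => ?_
  have hmem := (mem_homogeneousVanishingIdeal (Z := Z) hf).2 hZf
  rw [← heq, mem_homogeneousVanishingIdeal hf] at hmem
  exact hxf (hmem hxW)

/-- The irrelevant ideal lies strictly above the ideal of any nonempty set because the coordinates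
never vanish simultaneously at a projective point. It supplies the extra step that makes projective
dimension one less than the number of coordinates. -/
theorem homogeneousVanishingIdeal_lt_ker_constantCoeff {Z : Set (ProjSpace σ)}
    (hZ : Z.Nonempty) :
    homogeneousVanishingIdeal Z < RingHom.ker (constantCoeff (R := ℂ) (σ := σ)) := by
  obtain ⟨x, hx⟩ := hZ
  refine lt_of_le_of_ne (Ideal.span_le.2 fun f hf => ?_) fun heq => ?_
  · obtain ⟨⟨k, hk⟩, hfZ⟩ := hf
    have hfx := mem_zeroLocus_singleton.1 (hfZ hx)
    rw [SetLike.mem_coe, RingHom.mem_ker]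
    by_contra hne
    have hk0 : k = 0 := by
      by_contra hk0
      exact hne (hk.coeff_eq_zero (by simpa using Ne.symm hk0))
    subst hk0
    rw [← totalDegree_zero_iff_isHomogeneous, totalDegree_eq_zero_iff_eq_C] at hk
    rw [hk, eval_C] at hfx
    exact hne hfx
  · refine Projectivization.rep_nonzero x (funext fun s => ?_)
    have : (X s : MvPolynomial σ ℂ) ∈ homogeneousVanishingIdeal Z := by
      rw [heq, RingHom.mem_ker, constantCoeff_X]
    simpa using eval_rep_of_mem_homogeneousVanishingIdeal this hx

/-- The homogeneous vanishing ideal as a point of the prime spectrum. -/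
noncomputable def toPrimeSpectrum (Z : TopologicalSpace.IrreducibleCloseds (ProjSpace σ)) :
    PrimeSpectrum (MvPolynomial σ ℂ) :=
  ⟨homogeneousVanishingIdeal Z, isPrime_homogeneousVanishingIdeal Z.isIrreducible⟩

theorem toPrimeSpectrum_strictAnti : StrictAnti (toPrimeSpectrum (σ := σ)) := fun Z _ h =>
  (PrimeSpectrum.asIdeal_lt_asIdeal _ _).1
    (homogeneousVanishingIdeal_strictAnti Z.isClosed (SetLike.coe_ssubset_coe.2 h))

/-- Reversing a chain of irreducible closed sets gives a chain of primes; with the irrelevant ideal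
on top it is one step longer, and the Krull dimension of the polynomial ring is the number of
variables. -/
theorem length_add_one_le_card [Finite σ]
    (p : LTSeries (TopologicalSpace.IrreducibleCloseds (ProjSpace σ))) :
    p.length + 1 ≤ Nat.card σ := by
  have hdim : ringKrullDim (MvPolynomial σ ℂ) = Nat.card σ := by
    rw [MvPolynomial.ringKrullDim_of_isNoetherianRing, ringKrullDim_eq_zero_of_field, zero_add]
  let m : PrimeSpectrum (MvPolynomial σ ℂ) :=
    ⟨RingHom.ker (constantCoeff (R := ℂ) (σ := σ)), RingHom.ker_isPrime _⟩
  have hm : ∀ Z, toPrimeSpectrum Z < m := fun Z => (PrimeSpectrum.asIdeal_lt_asIdeal _ _).1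
    (homogeneousVanishingIdeal_lt_ker_constantCoeff Z.isIrreducible.nonempty)
  let q : LTSeries (PrimeSpectrum (MvPolynomial σ ℂ)) :=
    LTSeries.mk p.length (fun i => toPrimeSpectrum (p (Fin.rev i)))
      (fun i j h => toPrimeSpectrum_strictAnti (p.strictMono (Fin.rev_strictAnti h)))
  have hlt : q.last < m := hm _
  have hle := Order.LTSeries.length_le_krullDim (q.snoc m hlt)
  rw [← ringKrullDim, hdim, RelSeries.snoc_length] at hle
  exact Nat.cast_le.1 (WithBot.coe_le_coe.1 hle)

theorem topologicalKrullDim_le_of_card [Finite σ] {n : ℕ} (hn : Nat.card σ = n + 1) :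
    topologicalKrullDim (ProjSpace σ) ≤ n := by
  refine iSup_le fun p => ?_
  have h := length_add_one_le_card p
  rw [hn] at h
  exact Nat.cast_le.2 (Nat.le_of_succ_le_succ h)

/-- By the Nullstellensatz on the affine cone, a form vanishing on the zero set lies in the prime
ideal of `g`. -/
theorem isIrreducible_zeroLocus_singleton [Finite σ] {g : MvPolynomial σ ℂ} {k : ℕ}
    (hg : g.IsHomogeneous k) (hprime : (Ideal.span {g}).IsPrime) (hne : (zeroLocus {g}).Nonempty) :
    IsIrreducible (zeroLocus {g}) := by
  refine ⟨hne, ?_⟩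
  rw [isPreirreducible_iff_isClosed_union_isClosed]
  intro Z₁ Z₂ hZ₁ hZ₂ hsub
  by_contra! hcon
  rw [Set.not_subset, Set.not_subset] at hcon
  obtain ⟨⟨x, hx, hxZ⟩, y, hy, hyZ⟩ := hcon
  obtain ⟨f₁, k₁, hf₁, hZf₁, hxf₁⟩ := exists_separating_of_notMem hZ₁ hxZ
  obtain ⟨f₂, k₂, hf₂, hZf₂, hyf₂⟩ := exists_separating_of_notMem hZ₂ hyZ
  have hf := hf₁.mul hf₂
  have hvan : ∀ v : σ → ℂ, v ≠ 0 → eval v g = 0 → eval v (f₁ * f₂) = 0 := by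
    intro v hv hgv
    rw [map_mul, mul_eq_zero]
    rcases hsub ((mk_mem_zeroLocus_singleton hg hv).2 hgv) with h | h
    · exact Or.inl ((mk_mem_zeroLocus_singleton hf₁ hv).1 (hZf₁ h))
    · exact Or.inr ((mk_mem_zeroLocus_singleton hf₂ hv).1 (hZf₂ h))
  -- The vertex of the cone is not a projective point. There the value is `0 ^ (k₁ + k₂)` times the
  -- value at a point of the zero set, which is already zero.
  have hvan0 : eval (0 : σ → ℂ) (f₁ * f₂) = 0 := by
    have h1 := hvan _ (Projectivization.rep_nonzero x) (mem_zeroLocus_singleton.1 hx)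
    have h2 := hf.eval_smul (0 : ℂ) (Projectivization.rep x)
    rwa [h1, mul_zero, zero_smul] at h2
  have hmem : f₁ * f₂ ∈ Ideal.span {g} := by
    rw [← hprime.radical, ← vanishingIdeal_zeroLocus_eq_radical (K := ℂ),
      MvPolynomial.zeroLocus_span, mem_vanishingIdeal_iff]
    intro v hv
    have hgv : eval v g = 0 := by simpa [aeval_eq_eval] using hv g rfl
    rw [aeval_eq_eval]
    by_cases hv0 : v = 0
    · subst hv0; exact hvan0
    · exact hvan v hv0 hgv
  have hdvd : ∀ f ∈ Ideal.span {g}, ∀ z ∈ zeroLocus {g}, z ∈ zeroLocus {f} := by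
    intro f hf z hz
    obtain ⟨q, rfl⟩ := Ideal.mem_span_singleton.1 hf
    rw [mem_zeroLocus_singleton] at hz ⊢
    rw [map_mul, hz, zero_mul]
  rcases hprime.mem_or_mem hmem with h | h
  · exact hxf₁ (hdvd _ h x hx)
  · exact hyf₂ (hdvd _ h y hy)

theorem isIrreducible_univ [Finite σ] [Nonempty σ] :
    IsIrreducible (Set.univ : Set (ProjSpace σ)) := by
  have h : zeroLocus {(0 : MvPolynomial σ ℂ)} = Set.univ := by
    ext x; simp [mem_zeroLocus_singleton]
  rw [← h]
  refine isIrreducible_zeroLocus_singleton (isHomogeneous_zero _ _ 0) ?_ ?_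
  · rw [Ideal.span_singleton_eq_bot.2 rfl]
    exact Ideal.isPrime_bot
  · rw [h]
    exact ⟨mk 1 one_ne_zero, trivial⟩

/-- Every proper irreducible closed subset lies in an irreducible hypersurface. -/
theorem exists_irreducible_homogeneous_of_ne_univ {Z : Set (ProjSpace σ)} (hirr : IsIrreducible Z)
    (hZ : IsClosed Z) (hne : Z ≠ Set.univ) :
    ∃ (g : MvPolynomial σ ℂ) (k : ℕ), Irreducible g ∧ g.IsHomogeneous k ∧ Z ⊆ zeroLocus {g} := by
  classical
  have hprime := isPrime_homogeneousVanishingIdeal hirr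
  have hhom := isHomogeneous_homogeneousVanishingIdeal Z
  have hex : ∃ k : ℕ, ∃ g : MvPolynomial σ ℂ, g.IsHomogeneous k ∧ g ≠ 0 ∧
      g ∈ homogeneousVanishingIdeal Z := by
    obtain ⟨x, hx⟩ := (Set.ne_univ_iff_exists_notMem _).1 hne
    obtain ⟨f, k, hf, hZf, hxf⟩ := exists_separating_of_notMem hZ hx
    refine ⟨k, f, hf, ?_, (mem_homogeneousVanishingIdeal hf).2 hZf⟩
    rintro rfl
    exact hxf (mem_zeroLocus_singleton.2 (map_zero _))
  obtain ⟨g, hg, hg0, hgI⟩ := Nat.find_spec hex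
  -- `g` is a nonzero form of least degree in the prime ideal. The bound is needed for inhomogeneous
  -- elements too, since a factor of `g` is not known to be homogeneous; a factor in the ideal then
  -- takes up the whole degree and the other one is constant.
  have hmin : ∀ a ∈ homogeneousVanishingIdeal Z, a ≠ 0 → Nat.find hex ≤ a.totalDegree := by
    intro a ha ha0
    obtain ⟨i, hi⟩ : ∃ i, homogeneousComponent i a ≠ 0 := by
      by_contra! h
      exact ha0 (by rw [← sum_homogeneousComponent a]; exact Finset.sum_eq_zero fun i _ => h i)
    have h1 : Nat.find hex ≤ i := Nat.find_min' hex ⟨_, homogeneousComponent_isHomogeneous i a, hi,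
      homogeneousComponent_mem_of_mem hhom ha i⟩
    by_contra! h2
    exact hi (homogeneousComponent_eq_zero _ _ (by omega))
  have hunit : ∀ a b : MvPolynomial σ ℂ, g = a * b → a ∈ homogeneousVanishingIdeal Z → IsUnit b := by
    rintro a b rfl ha
    have ha0 : a ≠ 0 := left_ne_zero_of_mul hg0
    have hb0 : b ≠ 0 := right_ne_zero_of_mul hg0
    have h1 := hmin a ha ha0
    have h2 := hg.totalDegree hg0
    rw [totalDegree_mul_of_isDomain ha0 hb0] at h2
    have h3 : b.totalDegree = 0 := by omega
    rw [totalDegree_eq_zero_iff_eq_C] at h3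
    rw [h3]
    refine IsUnit.map C (isUnit_iff_ne_zero.2 fun h => hb0 ?_)
    rw [h3, h, map_zero]
  refine ⟨g, Nat.find hex, ⟨fun hu => hprime.ne_top (Ideal.eq_top_of_isUnit_mem _ hgI hu), ?_⟩, hg,
    (mem_homogeneousVanishingIdeal hg).1 hgI⟩
  intro a b hab
  rcases hprime.mem_or_mem (hab ▸ hgI) with h | h
  · exact Or.inr (hunit a b hab h)
  · exact Or.inl (hunit b a (hab.trans (mul_comm a b)) h)

end ProjSpace

theorem Topology.IsInducing.isIrreducible_of_image {X Y : Type*} [TopologicalSpace X]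
    [TopologicalSpace Y] {f : X → Y} (hf : Topology.IsInducing f) {s : Set X}
    (hs : IsIrreducible (f '' s)) : IsIrreducible s := by
  refine ⟨hs.nonempty.of_image, ?_⟩
  intro u v hu hv
  obtain ⟨u', hu', rfl⟩ := hf.isOpen_iff.1 hu
  obtain ⟨v', hv', rfl⟩ := hf.isOpen_iff.1 hv
  rintro ⟨x, hx, hxu⟩ ⟨y, hy, hyv⟩
  obtain ⟨_, ⟨z, hz, rfl⟩, hzu, hzv⟩ := hs.isPreirreducible u' v' hu' hv'
    ⟨_, Set.mem_image_of_mem f hx, hxu⟩ ⟨_, Set.mem_image_of_mem f hy, hyv⟩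
  exact ⟨z, hz, hzu, hzv⟩

open TopologicalSpace in
-- Irreducible closed subsets of the subspace correspond to those of the ambient space lying below
-- `V`. All dimensions can therefore be compared inside one poset.
theorem topologicalKrullDim_coe_eq_height {X : Type*} [TopologicalSpace X]
    (V : IrreducibleCloseds X) :
    topologicalKrullDim ↥(V : Set X) = (Order.height V : WithBot ℕ∞) := by
  rw [Order.height_eq_krullDim_Iic]
  refine le_antisymm ?_ ?_
  · have hind : Topology.IsInducing (Subtype.val : ↥(V : Set X) → X) := Topology.IsInducing.subtypeVal
    let f : IrreducibleCloseds ↥(V : Set X) → Set.Iic V := fun Z =>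
      ⟨Z.map Subtype.val hind.continuous, by
        change closure _ ⊆ (V : Set X)
        refine closure_minimal ?_ V.isClosed
        rintro _ ⟨x, -, rfl⟩
        exact x.2⟩
    refine Order.krullDim_le_of_strictMono f fun Z W h => ?_
    exact IrreducibleCloseds.map_strictMono_of_isInducing hind h
  · let f : Set.Iic V → IrreducibleCloseds ↥(V : Set X) := fun Z =>
      ⟨Subtype.val ⁻¹' (Z.1 : Set X), by
        have himg : Subtype.val '' (Subtype.val ⁻¹' (Z.1 : Set X) : Set ↥(V : Set X)) = Z.1 := by
          rw [Subtype.image_preimage_coe]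
          exact Set.inter_eq_right.2 Z.2
        have := Z.1.isIrreducible
        rw [← himg] at this
        exact Topology.IsInducing.subtypeVal.isIrreducible_of_image this,
        Z.1.isClosed.preimage continuous_subtype_val⟩
    refine Order.krullDim_le_of_strictMono f fun Z W h => ?_
    refine lt_of_le_of_ne (fun x hx => (show Z.1 ≤ W.1 from h.le) hx) fun heq => h.not_ge ?_
    intro x hx
    have : (⟨x, W.2 hx⟩ : ↥(V : Set X)) ∈ f W := hx
    rw [← heq] at this
    exact this

end

/-! ### Polynomial families of linear spaces over a chart, and chains of closures inside them. -/

section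

open MvPolynomial

/-- Functions on affine space that are given by a polynomial. -/
def IsPolyFun {ι : Type*} (f : (ι → ℂ) → ℂ) : Prop := ∃ p : MvPolynomial ι ℂ, ∀ a, f a = eval a p

namespace IsPolyFun

variable {ι : Type*} {f g : (ι → ℂ) → ℂ}

theorem const (c : ℂ) : IsPolyFun fun _ : ι → ℂ => c := ⟨C c, fun _ => (eval_C c).symm⟩

theorem coord (i : ι) : IsPolyFun fun a : ι → ℂ => a i := ⟨X i, fun _ => (eval_X i).symm⟩

theorem add (hf : IsPolyFun f) (hg : IsPolyFun g) : IsPolyFun fun a => f a + g a := by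
  obtain ⟨p, hp⟩ := hf
  obtain ⟨q, hq⟩ := hg
  exact ⟨p + q, fun a => by simp only [hp, hq, map_add]⟩

theorem mul (hf : IsPolyFun f) (hg : IsPolyFun g) : IsPolyFun fun a => f a * g a := by
  obtain ⟨p, hp⟩ := hf
  obtain ⟨q, hq⟩ := hg
  exact ⟨p * q, fun a => by simp only [hp, hq, map_mul]⟩

theorem neg (hf : IsPolyFun f) : IsPolyFun fun a => -f a := by
  obtain ⟨p, hp⟩ := hf
  exact ⟨-p, fun a => by simp only [hp, map_neg]⟩

theorem sub (hf : IsPolyFun f) (hg : IsPolyFun g) : IsPolyFun fun a => f a - g a := by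
  simpa only [sub_eq_add_neg] using hf.add hg.neg

theorem sum {κ : Type*} (s : Finset κ) {F : κ → (ι → ℂ) → ℂ} (hF : ∀ k ∈ s, IsPolyFun (F k)) :
    IsPolyFun fun a => ∑ k ∈ s, F k a := by
  classical
  induction s using Finset.induction with
  | empty => simpa using const 0
  | insert k s hk ih =>
    simp only [Finset.sum_insert hk]
    exact (hF k (s.mem_insert_self k)).add (ih fun l hl => hF l (Finset.mem_insert_of_mem hl))

theorem prod {κ : Type*} (s : Finset κ) {F : κ → (ι → ℂ) → ℂ} (hF : ∀ k ∈ s, IsPolyFun (F k)) :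
    IsPolyFun fun a => ∏ k ∈ s, F k a := by
  classical
  induction s using Finset.induction with
  | empty => simpa using const 1
  | insert k s hk ih =>
    simp only [Finset.prod_insert hk]
    exact (hF k (s.mem_insert_self k)).mul (ih fun l hl => hF l (Finset.mem_insert_of_mem hl))

theorem det {κ : Type*} [Fintype κ] [DecidableEq κ] {A : (ι → ℂ) → Matrix κ κ ℂ}
    (hA : ∀ i j, IsPolyFun fun a => A a i j) : IsPolyFun fun a => (A a).det := by
  simp only [Matrix.det_apply']
  exact sum _ fun τ _ => (const _).mul (prod _ fun i _ => hA _ _)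

theorem comp {σ : Type*} {h : (σ → ℂ) → ℂ} (hh : IsPolyFun h) {G : (ι → ℂ) → σ → ℂ}
    (hG : ∀ s, IsPolyFun fun a => G a s) : IsPolyFun fun a => h (G a) := by
  obtain ⟨p, hp⟩ := hh
  choose P hP using hG
  refine ⟨bind₁ P p, fun a => ?_⟩
  have hGa : G a = fun s => eval a (P s) := funext fun s => hP s a
  change h (G a) = _
  rw [hp, hGa, ← aeval_eq_eval, ← aeval_eq_eval, aeval_bind₁]

theorem linear {σ : Type*} [Fintype σ] (l : (σ → ℂ) →ₗ[ℂ] ℂ) {G : (ι → ℂ) → σ → ℂ}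
    (hG : ∀ s, IsPolyFun fun a => G a s) : IsPolyFun fun a => l (G a) := by
  classical
  have h : (fun a => l (G a)) = fun a => ∑ s, G a s * l fun t => if s = t then 1 else 0 :=
    funext fun a => l.pi_apply_eq_sum_univ (G a)
  rw [h]
  exact sum _ fun s _ => (hG s).mul (const _)

end IsPolyFun

/-- A polynomial involution of the affine chart `x o = 1`. -/
structure ChartInvolution {σ : Type} (o : σ) where
  toFun : (σ → ℂ) → σ → ℂ
  isPolyFun : ∀ s, IsPolyFun fun x => toFun x s
  apply_base : ∀ x, x o = 1 → toFun x o = 1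
  involutive : ∀ x, x o = 1 → toFun (toFun x) = x

/-- The identity as a chart involution. -/
def ChartInvolution.refl {σ : Type} (o : σ) : ChartInvolution o where
  toFun x := x
  isPolyFun s := IsPolyFun.coord s
  apply_base _ h := h
  involutive _ _ := rfl

/-- The composite of `h` with the involution is polynomial and takes on the image of `S` the values
of `h` on `S`. A test function on the original family is thus enough. -/
theorem ChartInvolution.mk_notMem_closure {σ : Type} {o : σ} (ψ : ChartInvolution o)
    {S : Set (σ → ℂ)} (hS : ∀ v ∈ S, v o = 1) {h : (σ → ℂ) → ℂ} (hh : IsPolyFun h)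
    (hSh : ∀ v ∈ S, h v = 0) {w : σ → ℂ} (hw : w o = 1) (hhw : h w ≠ 0) (h0 : ψ.toFun w ≠ 0) :
    ProjSpace.mk (ψ.toFun w) h0 ∉ closure (ProjSpace.ofVectors (ψ.toFun '' S)) := by
  obtain ⟨p, hp⟩ := hh.comp ψ.isPolyFun
  beta_reduce at hp
  refine ProjSpace.mk_notMem_closure_ofVectors (o := o) (p := p) ?_ ?_ (ψ.apply_base w hw) ?_ h0
  · rintro _ ⟨v, hv, rfl⟩
    exact ψ.apply_base v (hS v hv)
  · rintro _ ⟨v, hv, rfl⟩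
    rw [← hp, ψ.involutive v (hS v hv), hSh v hv]
  · rwa [← hp, ψ.involutive w hw]

/-- A family of linear subspaces of the space of vectors supported on a set `T` of coordinates,
spanned by columns that depend polynomially on the coordinates outside `T`. -/
structure LinearFamily (σ κ : Type) where
  o : σ
  T : Set σ
  o_notMem : o ∉ T
  col : κ → (σ → ℂ) → σ → ℂ
  isPolyFun_col : ∀ k s, IsPolyFun fun x => col k x s
  col_eq_zero : ∀ k x, ∀ s ∉ T, col k x s = 0

namespace LinearFamily

variable {σ κ : Type} (D : LinearFamily σ κ)

open Classical in
/-- Set the coordinate `o` to one and the coordinates in `T` to zero. -/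
noncomputable def base (x : σ → ℂ) : σ → ℂ := fun s => if s = D.o then 1 else if s ∈ D.T then 0 else x s

theorem base_o (x : σ → ℂ) : D.base x D.o = 1 := by simp [base]

theorem base_of_mem (x : σ → ℂ) {s : σ} (hs : s ∈ D.T) : D.base x s = 0 := by
  have : s ≠ D.o := by rintro rfl; exact D.o_notMem hs
  simp [base, this, hs]

theorem base_of_notMem (x : σ → ℂ) {s : σ} (hs : s ∉ D.T) (ho : s ≠ D.o) : D.base x s = x s := by
  simp [base, ho, hs]

theorem base_congr {x y : σ → ℂ} (h : ∀ s ∉ D.T, s ≠ D.o → x s = y s) : D.base x = D.base y := by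
  funext s
  unfold base
  split_ifs with h1 h2
  · rfl
  · rfl
  · exact h s h2 h1

theorem isPolyFun_base {ι : Type*} {G : (ι → ℂ) → σ → ℂ} (hG : ∀ s, IsPolyFun fun a => G a s)
    (s : σ) : IsPolyFun fun a => D.base (G a) s := by
  unfold base
  split_ifs
  · exact IsPolyFun.const 1
  · exact IsPolyFun.const 0
  · exact hG s

variable [Fintype κ]

/-- The total space of the family, parametrized by the base coordinates and the coefficients of
the columns. -/
noncomputable def param (x : σ → ℂ) (q : κ → ℂ) : σ → ℂ :=
  D.base x + ∑ k, q k • D.col k (D.base x)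

theorem param_of_notMem (x : σ → ℂ) (q : κ → ℂ) {s : σ} (hs : s ∉ D.T) :
    D.param x q s = D.base x s := by
  simp [param, Finset.sum_apply, D.col_eq_zero _ _ s hs]

theorem param_o (x : σ → ℂ) (q : κ → ℂ) : D.param x q D.o = 1 := by
  rw [D.param_of_notMem x q D.o_notMem, base_o]

theorem base_param (x : σ → ℂ) (q : κ → ℂ) : D.base (D.param x q) = D.base x := by
  refine D.base_congr (fun s hs ho => ?_) |>.trans (D.base_congr fun s hs ho => rfl)
  rw [D.param_of_notMem x q hs, D.base_of_notMem x hs ho]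

theorem isPolyFun_param {ι : Type*} {G : (ι → ℂ) → σ → ℂ} (hG : ∀ s, IsPolyFun fun a => G a s)
    {Q : (ι → ℂ) → κ → ℂ} (hQ : ∀ k, IsPolyFun fun a => Q a k) (s : σ) :
    IsPolyFun fun a => D.param (G a) (Q a) s := by
  simp only [param, Pi.add_apply, Finset.sum_apply, Pi.smul_apply, smul_eq_mul]
  exact (D.isPolyFun_base hG s).add
    (IsPolyFun.sum _ fun k _ => (hQ k).mul ((D.isPolyFun_col k s).comp (D.isPolyFun_base hG)))

/-- The total space of the family as a subset of affine space. -/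
def total : Set (σ → ℂ) := Set.range fun a : (σ → ℂ) × (κ → ℂ) => D.param a.1 a.2

theorem apply_o_of_mem_total {x : σ → ℂ} (hx : x ∈ D.total) : x D.o = 1 := by
  obtain ⟨a, rfl⟩ := hx
  exact D.param_o _ _

open Classical in
/-- The part of the total space where only the base coordinates in `B` and the coefficients in `K`
vary, while the other base coordinates agree with `b` and the other coefficients vanish. -/
def restricted (b : σ → ℂ) (B : Finset σ) (K : Finset κ) : Set (σ → ℂ) :=
  Set.range fun a : σ ⊕ κ → ℂ =>
    D.param (fun s => if s ∈ B then a (Sum.inl s) else b s)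
      (fun k => if k ∈ K then a (Sum.inr k) else 0)

theorem restricted_subset_total (b : σ → ℂ) (B : Finset σ) (K : Finset κ) :
    D.restricted b B K ⊆ D.total := by
  rintro _ ⟨a, rfl⟩
  exact ⟨(_, _), rfl⟩

theorem total_eq_restricted_univ [Fintype σ] (b : σ → ℂ) :
    D.total = D.restricted b Finset.univ Finset.univ := by
  refine Set.Subset.antisymm ?_ (D.restricted_subset_total _ _ _)
  rintro _ ⟨⟨x, q⟩, rfl⟩
  exact ⟨Sum.elim x q, by simp⟩

theorem restricted_mono (b : σ → ℂ) {B B' : Finset σ} {K K' : Finset κ} (hB : B ⊆ B')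
    (hK : K ⊆ K') : D.restricted b B K ⊆ D.restricted b B' K' := by
  classical
  rintro _ ⟨a, rfl⟩
  refine ⟨Sum.elim (fun s => if s ∈ B then a (Sum.inl s) else b s)
    (fun k => if k ∈ K then a (Sum.inr k) else 0), ?_⟩
  simp only [Sum.elim_inl, Sum.elim_inr]
  congr 1
  · funext s
    by_cases h : s ∈ B
    · simp [h, hB h]
    · simp [h]
  · funext k
    by_cases h : k ∈ K
    · simp [h, hK h]
    · simp [h]

theorem isIrreducible_closure_restricted (ψ : ChartInvolution D.o) (b : σ → ℂ) (B : Finset σ)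
    (K : Finset κ) :
    IsIrreducible (closure (ProjSpace.ofVectors (ψ.toFun '' D.restricted b B K))) := by
  classical
  rw [restricted, ← Set.range_comp]
  refine ProjSpace.isIrreducible_closure_ofVectors_range (fun s => ?_) fun a h => ?_
  · refine (ψ.isPolyFun s).comp (D.isPolyFun_param (fun s => ?_) fun k => ?_)
    · split_ifs
      · exact IsPolyFun.coord _
      · exact IsPolyFun.const _
    · split_ifs
      · exact IsPolyFun.coord _
      · exact IsPolyFun.const _
  · have := ψ.apply_base _ (D.param_o (fun s => if s ∈ B then a (Sum.inl s) else b s)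
      (fun k => if k ∈ K then a (Sum.inr k) else 0))
    have h2 := congrFun h D.o
    simp only [Function.comp_apply, this, Pi.zero_apply] at h2
    exact one_ne_zero h2

open TopologicalSpace

/-- The closure in projective space of the image of a restricted total space. -/
def restrictedClosure (ψ : ChartInvolution D.o) (b : σ → ℂ) (B : Finset σ) (K : Finset κ) :
    IrreducibleCloseds (ProjSpace σ) :=
  ⟨closure (ProjSpace.ofVectors (ψ.toFun '' D.restricted b B K)),
    D.isIrreducible_closure_restricted ψ b B K, isClosed_closure⟩

theorem restrictedClosure_lt (ψ : ChartInvolution D.o) (b : σ → ℂ) {B B' : Finset σ}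
    {K K' : Finset κ} (hB : B ⊆ B') (hK : K ⊆ K') {h : (σ → ℂ) → ℂ} (hh : IsPolyFun h)
    (h1 : ∀ x ∈ D.restricted b B K, h x = 0) (h2 : ∃ x ∈ D.restricted b B' K', h x ≠ 0) :
    D.restrictedClosure ψ b B K < D.restrictedClosure ψ b B' K' := by
  obtain ⟨w, hw, hhw⟩ := h2
  have hwo := D.apply_o_of_mem_total (D.restricted_subset_total _ _ _ hw)
  have h0 : ψ.toFun w ≠ 0 := fun h => by
    have := ψ.apply_base w hwo
    rw [h] at this
    exact zero_ne_one this
  refine lt_of_le_of_ne (closure_mono (ProjSpace.ofVectors_mono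
    (Set.image_mono (D.restricted_mono b hB hK)))) fun heq => ?_
  refine ψ.mk_notMem_closure (fun v hv => D.apply_o_of_mem_total
    (D.restricted_subset_total _ _ _ hv)) hh h1 hwo hhw h0 ?_
  have hmem : ProjSpace.mk (ψ.toFun w) h0 ∈ D.restrictedClosure ψ b B' K' :=
    subset_closure (ProjSpace.mk_mem_ofVectors (Set.mem_image_of_mem _ hw) h0)
  rw [← heq] at hmem
  exact hmem

/-- Within the single fibre over `b`, each further independent column enlarges the closure: a linear
functional killing the earlier columns but not the new one separates. -/
theorem card_le_height_restrictedClosure_empty [Fintype σ] (ψ : ChartInvolution D.o) (b : σ → ℂ)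
    (K : Finset κ) (hK : LinearIndepOn ℂ (fun k => D.col k (D.base b)) (K : Set κ)) :
    (K.card : ℕ∞) ≤ Order.height (D.restrictedClosure ψ b ∅ K) := by
  classical
  induction K using Finset.induction with
  | empty => simp
  | insert k K hk ih =>
    rw [Finset.coe_insert, linearIndepOn_insert (by simpa using hk)] at hK
    rw [Finset.card_insert_of_notMem hk, Nat.cast_add, Nat.cast_one]
    refine (add_le_add_left (ih hK.1) 1).trans (Order.height_add_one_le ?_)
    obtain ⟨l, hl, hker⟩ := Submodule.exists_le_ker_of_notMem hK.2
    refine D.restrictedClosure_lt ψ b subset_rfl (Finset.subset_insert _ _)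
      (h := fun x => l (x - D.base b)) ?_ ?_ ?_
    · exact IsPolyFun.linear l fun s => (IsPolyFun.coord s).sub (IsPolyFun.const _)
    · rintro _ ⟨a, rfl⟩
      simp only [Finset.notMem_empty, if_false, param, add_sub_cancel_left, map_sum, map_smul]
      refine Finset.sum_eq_zero fun k' _ => ?_
      split_ifs with h
      · have : D.col k' (D.base b) ∈ LinearMap.ker l :=
          hker (Submodule.subset_span ⟨k', h, rfl⟩)
        rw [LinearMap.mem_ker.1 this, smul_zero]
      · rw [zero_smul]
    · refine ⟨_, ⟨Sum.elim 0 (Pi.single k 1), rfl⟩, ?_⟩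
      simp only [Finset.notMem_empty, if_false, param, add_sub_cancel_left, map_sum, map_smul]
      rw [Finset.sum_eq_single k]
      · simpa using hl
      · intro k' _ hk'
        simp [hk']
      · simp

/-- Starting from the chain in one fibre, each freed base coordinate `s` gives one more strict step,
detected by `x s - b s`, because columns do not affect coordinates outside `T`. -/
theorem card_add_card_le_height_restrictedClosure [Fintype σ] (ψ : ChartInvolution D.o) (b : σ → ℂ)
    (K : Finset κ) (hK : LinearIndepOn ℂ (fun k => D.col k (D.base b)) (K : Set κ))
    (B : Finset σ) (hB : ∀ s ∈ B, s ∉ D.T ∧ s ≠ D.o) :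
    ((B.card + K.card : ℕ) : ℕ∞) ≤ Order.height (D.restrictedClosure ψ b B K) := by
  classical
  induction B using Finset.induction with
  | empty => simpa using D.card_le_height_restrictedClosure_empty ψ b K hK
  | insert s B hs ih =>
    obtain ⟨hsT, hso⟩ := hB s (B.mem_insert_self s)
    have ih := ih fun t ht => hB t (Finset.mem_insert_of_mem ht)
    have hcard : (insert s B).card + K.card = B.card + K.card + 1 := by
      rw [Finset.card_insert_of_notMem hs]; ring
    rw [hcard, Nat.cast_add, Nat.cast_one]
    refine (add_le_add_left ih 1).trans (Order.height_add_one_le ?_)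
    refine D.restrictedClosure_lt ψ b (Finset.subset_insert _ _) subset_rfl
      (h := fun x => x s - b s) ((IsPolyFun.coord s).sub (IsPolyFun.const _)) ?_ ?_
    · rintro _ ⟨a, rfl⟩
      simp [D.param_of_notMem _ _ hsT, D.base_of_notMem _ hsT hso, hs]
    · refine ⟨_, ⟨Sum.elim (fun t => b t + 1) 0, rfl⟩, ?_⟩
      simp [D.param_of_notMem _ _ hsT, D.base_of_notMem _ hsT hso]

/-- The closure in projective space of the image of the total space. -/
def totalClosure [Fintype σ] (ψ : ChartInvolution D.o) : IrreducibleCloseds (ProjSpace σ) :=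
  ⟨closure (ProjSpace.ofVectors (ψ.toFun '' D.total)), by
    rw [D.total_eq_restricted_univ 0]
    exact D.isIrreducible_closure_restricted ψ 0 _ _, isClosed_closure⟩

theorem card_add_card_le_height_totalClosure [Fintype σ] (ψ : ChartInvolution D.o) (b : σ → ℂ)
    (K : Finset κ) (hK : LinearIndepOn ℂ (fun k => D.col k (D.base b)) (K : Set κ))
    (B : Finset σ) (hB : ∀ s ∈ B, s ∉ D.T ∧ s ≠ D.o) :
    ((B.card + K.card : ℕ) : ℕ∞) ≤ Order.height (D.totalClosure ψ) :=
  (D.card_add_card_le_height_restrictedClosure ψ b K hK B hB).trans (Order.height_mono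
    (closure_mono (ProjSpace.ofVectors_mono (Set.image_mono (D.restricted_subset_total b B K)))))

/-- If the columns never span a space of dimension greater than `K.card`, and those in `K` are
linearly independent at `b`, then the total space does not fill the fibre over `b`, not even after
taking the Zariski closure. -/
theorem mk_notMem_totalClosure [Fintype σ] (ψ : ChartInvolution D.o) (b : σ → ℂ)
    (K : Finset κ) (hK : LinearIndepOn ℂ (fun k => D.col k (D.base b)) (K : Set κ))
    (hrank : ∀ x, Module.finrank ℂ
      (Submodule.span ℂ (Set.range fun k => D.col k (D.base x))) ≤ K.card)
    {v : σ → ℂ} (hvT : ∀ s ∉ D.T, v s = 0)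
    (hv : v ∉ Submodule.span ℂ (Set.range fun k => D.col k (D.base b)))
    (h0 : ψ.toFun (D.base b + v) ≠ 0) :
    ProjSpace.mk (ψ.toFun (D.base b + v)) h0 ∉ D.totalClosure ψ := by
  classical
  -- The `K` columns together with the displacement from the base point: on the family these `K.card
  -- + 1` vectors lie in a space of dimension at most `K.card`, whereas at `D.base b + v` they are
  -- independent.
  let w : Option K → (σ → ℂ) → σ → ℂ := fun i x =>
    i.elim (x - D.base x) fun k => D.col k (D.base x)
  have hbase : D.base (D.base b + v) = D.base b :=
    D.base_congr fun s hs ho => by simp [hvT s hs, D.base_of_notMem b hs ho]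
  have hLI : LinearIndependent ℂ fun i => w i (D.base b + v) := by
    rw [linearIndependent_option]
    refine ⟨?_, ?_⟩
    · simpa [w, hbase, Function.comp_def] using hK.linearIndependent
    · simp only [w, hbase, Option.elim_none, add_sub_cancel_left]
      intro hmem
      refine hv (Submodule.span_mono ?_ hmem)
      rintro _ ⟨k, rfl⟩
      exact ⟨k, rfl⟩
  -- A fixed left inverse selects one maximal minor, normalized so that its matrix is the identity
  -- at the chosen point.
  obtain ⟨L, hL⟩ := LinearMap.exists_leftInverse_of_injective
    (Fintype.linearCombination ℂ fun i => w i (D.base b + v))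
    (LinearMap.ker_eq_bot.2 (hLI.fintypeLinearCombination_injective))
  have hLw : ∀ i, L (w i (D.base b + v)) = Pi.single i 1 := fun i => by
    have := LinearMap.congr_fun hL (Pi.single i 1)
    simpa [Fintype.linearCombination_apply_single] using this
  have hw : ∀ i s, IsPolyFun fun x => w i x s := by
    rintro (_ | k) s
    · exact (IsPolyFun.coord s).sub (D.isPolyFun_base IsPolyFun.coord s)
    · exact (D.isPolyFun_col k s).comp (D.isPolyFun_base IsPolyFun.coord)
  refine ψ.mk_notMem_closure (h := fun x => (Matrix.of fun i j => L (w i x) j).det)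
    (fun v hv => D.apply_o_of_mem_total hv) ?_ ?_ ?_ ?_ h0
  · exact IsPolyFun.det fun i j => IsPolyFun.linear (LinearMap.proj j ∘ₗ L) (hw i)
  · rintro _ ⟨⟨x, q⟩, rfl⟩
    by_contra hdet
    have hLIx : LinearIndependent ℂ fun i => w i (D.param x q) :=
      LinearIndependent.of_comp L (Matrix.linearIndependent_rows_of_det_ne_zero hdet)
    have hsub : Submodule.span ℂ (Set.range fun i => w i (D.param x q)) ≤
        Submodule.span ℂ (Set.range fun k => D.col k (D.base x)) := by
      refine Submodule.span_le.2 ?_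
      rintro _ ⟨_ | k, rfl⟩
      · change D.param x q - D.base (D.param x q) ∈ _
        rw [D.base_param, param, add_sub_cancel_left]
        exact Submodule.sum_mem _ fun k _ =>
          Submodule.smul_mem _ _ (Submodule.subset_span (Set.mem_range_self k))
      · change D.col k (D.base (D.param x q)) ∈ _
        rw [D.base_param]
        exact Submodule.subset_span ⟨k, rfl⟩
    have h1 := Submodule.finrank_mono hsub
    rw [finrank_span_eq_card hLIx, Fintype.card_option, Fintype.card_coe] at h1
    have := hrank x
    omega
  · simp [hvT _ D.o_notMem, D.base_o]
  · have : (Matrix.of fun i j => L (w i (D.base b + v)) j) = 1 := by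
      ext i j
      rw [Matrix.of_apply, hLw, Matrix.one_apply, Pi.single_apply]
      simp [eq_comm]
    simp [this]

/-- Add a constant column. -/
def addColumn (u : σ → ℂ) (hu : ∀ s ∉ D.T, u s = 0) : LinearFamily σ (Option κ) where
  o := D.o
  T := D.T
  o_notMem := D.o_notMem
  col i x := i.elim u fun k => D.col k x
  isPolyFun_col := by
    rintro (_ | k) s
    · exact IsPolyFun.const _
    · exact D.isPolyFun_col k s
  col_eq_zero := by
    rintro (_ | k) x s hs
    · exact hu s hs
    · exact D.col_eq_zero k x s hs

theorem total_subset_total_addColumn (u : σ → ℂ) (hu : ∀ s ∉ D.T, u s = 0) :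
    D.total ⊆ (D.addColumn u hu).total := by
  rintro _ ⟨⟨x, q⟩, rfl⟩
  refine ⟨(x, fun i => i.elim 0 q), ?_⟩
  simp only [param, Fintype.sum_option, Option.elim_none, Option.elim_some, zero_smul, zero_add]
  rfl

theorem base_add_mem_total_addColumn (u : σ → ℂ) (hu : ∀ s ∉ D.T, u s = 0) (b : σ → ℂ) :
    D.base b + u ∈ (D.addColumn u hu).total := by
  refine ⟨(b, fun i => i.elim 1 0), ?_⟩
  simp only [param, Fintype.sum_option, Option.elim_none, Option.elim_some, one_smul, Pi.zero_apply,
    zero_smul, Finset.sum_const_zero, add_zero]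
  rfl

end LinearFamily

end

/-! ### Exact dimensions in codimension one and two. -/

section

open MvPolynomial TopologicalSpace

namespace ProjSpace

variable {σ : Type}

/-- The whole projective space as an irreducible closed set. -/
def univIrreducible [Finite σ] [Nonempty σ] : IrreducibleCloseds (ProjSpace σ) :=
  ⟨Set.univ, isIrreducible_univ, isClosed_univ⟩

theorem lt_univIrreducible [Finite σ] [Nonempty σ] {V : IrreducibleCloseds (ProjSpace σ)}
    {x : ProjSpace σ} (hx : x ∉ V) : V < univIrreducible :=
  lt_of_le_of_ne (fun y _ => Set.mem_univ y) fun h => hx (h ▸ Set.mem_univ x)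

theorem height_le_of_card [Finite σ] (V : IrreducibleCloseds (ProjSpace σ)) {n : ℕ}
    (hn : Nat.card σ = n + 1) : Order.height V ≤ n :=
  WithBot.coe_le_coe.1 ((Order.height_le_krullDim V).trans (topologicalKrullDim_le_of_card hn))

theorem topologicalKrullDim_eq_height_univIrreducible [Finite σ] [Nonempty σ] :
    topologicalKrullDim (ProjSpace σ) =
      (Order.height (univIrreducible (σ := σ)) : WithBot ℕ∞) := by
  rw [← topologicalKrullDim_coe_eq_height]
  exact (IsHomeomorph.topologicalKrullDim_eq _
    (Homeomorph.Set.univ (ProjSpace σ)).isHomeomorph).symm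

theorem zeroLocus_singleton_ne_univ [Nonempty σ] {g : MvPolynomial σ ℂ} {k : ℕ}
    (hg : g.IsHomogeneous k) (hg0 : g ≠ 0) : zeroLocus {g} ≠ Set.univ := by
  intro h
  obtain ⟨o⟩ := ‹Nonempty σ›
  have : X o * g = 0 := by
    refine MvPolynomial.funext fun v => ?_
    rw [map_mul, map_zero, eval_X, mul_eq_zero]
    by_cases hv : v = 0
    · left; rw [hv]; rfl
    · right
      exact (mk_mem_zeroLocus_singleton hg hv).1 (h ▸ Set.mem_univ _)
  exact hg0 ((mul_eq_zero.1 this).resolve_left (X_ne_zero o))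

/-- An irreducible closed set of codimension one is a hypersurface. -/
theorem isHypersurface_of_le_height [Finite σ] [Nonempty σ] {V : IrreducibleCloseds (ProjSpace σ)}
    {n : ℕ} (hn : Nat.card σ = n + 2) (hV : n ≤ Order.height V) {x : ProjSpace σ} (hx : x ∉ V) :
    IsHypersurface (V : Set (ProjSpace σ)) := by
  have hne : (V : Set (ProjSpace σ)) ≠ Set.univ := fun h =>
    hx (SetLike.mem_coe.1 (h ▸ Set.mem_univ x))
  obtain ⟨g, k, hirr, hg, hVg⟩ := exists_irreducible_homogeneous_of_ne_univ V.isIrreducible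
    V.isClosed hne
  refine ⟨g, hirr, ⟨k, hg⟩, ?_⟩
  have hprime : (Ideal.span {g}).IsPrime :=
    (Ideal.span_singleton_prime hirr.ne_zero).2 hirr.prime
  let H : IrreducibleCloseds (ProjSpace σ) := ⟨zeroLocus {g},
    isIrreducible_zeroLocus_singleton hg hprime (V.isIrreducible.nonempty.mono hVg),
    isClosed_zeroLocus_singleton hg⟩
  by_contra hVH
  have h1 : V < H := lt_of_le_of_ne hVg fun h => hVH (congrArg SetLike.coe h)
  obtain ⟨y, hy⟩ := (Set.ne_univ_iff_exists_notMem _).1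
    (zeroLocus_singleton_ne_univ hg hirr.ne_zero)
  have h2 : H < univIrreducible := lt_univIrreducible (x := y) hy
  have h3 := Order.height_add_one_le h1
  have h4 := Order.height_add_one_le h2
  have h5 := height_le_of_card (univIrreducible (σ := σ)) hn
  have h6 : ((n + 2 : ℕ) : ℕ∞) ≤ ((n + 1 : ℕ) : ℕ∞) :=
    calc ((n + 2 : ℕ) : ℕ∞) = (n : ℕ∞) + 1 + 1 := by push_cast; ring
      _ ≤ Order.height V + 1 + 1 := by gcongr
      _ ≤ Order.height H + 1 := by gcongr
      _ ≤ _ := h4.trans h5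
  have := Nat.cast_le.1 h6
  omega

end ProjSpace

theorem ENat.eq_of_chain_one {n : ℕ} {a b : ℕ∞} (ha : n ≤ a) (hab : a + 1 ≤ b)
    (hb : b ≤ ((n + 1 : ℕ) : ℕ∞)) : a = n ∧ b = ((n + 1 : ℕ) : ℕ∞) := by
  have h : a + 1 ≤ n + 1 := hab.trans (by exact_mod_cast hb)
  have ha' : a ≤ n := (ENat.add_le_add_iff_right ENat.one_ne_top).1 h
  obtain rfl := le_antisymm ha' ha
  exact ⟨rfl, le_antisymm hb (by exact_mod_cast hab)⟩

namespace LinearFamily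

open ProjSpace

variable {σ κ : Type} (D : LinearFamily σ κ)

theorem toFun_ne_zero (ψ : ChartInvolution D.o) {w : σ → ℂ} (hw : w D.o = 1) :
    ψ.toFun w ≠ 0 := fun h => by
  have := ψ.apply_base w hw
  rw [h] at this
  exact zero_ne_one this

theorem base_add_o (b : σ → ℂ) {v : σ → ℂ} (hv : ∀ s ∉ D.T, v s = 0) : (D.base b + v) D.o = 1 := by
  rw [Pi.add_apply, D.base_o, hv _ D.o_notMem, add_zero]

variable [Fintype σ] [Fintype κ]

/-- The dimension of a family whose generic member has codimension one in its fibre. -/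
theorem codim_one (ψ : ChartInvolution D.o) (b : σ → ℂ) (K : Finset κ)
    (hK : LinearIndepOn ℂ (fun k => D.col k (D.base b)) (K : Set κ))
    (hrank : ∀ x, Module.finrank ℂ
      (Submodule.span ℂ (Set.range fun k => D.col k (D.base x))) ≤ K.card)
    {v : σ → ℂ} (hvT : ∀ s ∉ D.T, v s = 0)
    (hv : v ∉ Submodule.span ℂ (Set.range fun k => D.col k (D.base b)))
    (B : Finset σ) (hB : ∀ s ∈ B, s ∉ D.T ∧ s ≠ D.o) {n : ℕ} (hn : B.card + K.card = n)
    (hσ : Nat.card σ = n + 2) :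
    topologicalKrullDim (ProjSpace σ) = ((n + 1 : ℕ) : WithBot ℕ∞) ∧
    topologicalKrullDim ↥(D.totalClosure ψ : Set (ProjSpace σ)) = (n : WithBot ℕ∞) ∧
    IsHypersurface (D.totalClosure ψ : Set (ProjSpace σ)) := by
  have : Nonempty σ := ⟨D.o⟩
  have h0 := D.toFun_ne_zero ψ (D.base_add_o b hvT)
  have hx := D.mk_notMem_totalClosure ψ b K hK hrank hvT hv h0
  have h1 := D.card_add_card_le_height_totalClosure ψ b K hK B hB
  rw [hn] at h1
  obtain ⟨h2, h3⟩ := ENat.eq_of_chain_one h1 (Order.height_add_one_le (lt_univIrreducible hx))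
    (height_le_of_card _ hσ)
  refine ⟨?_, ?_, isHypersurface_of_le_height hσ h1 hx⟩
  · rw [topologicalKrullDim_eq_height_univIrreducible, h3]; rfl
  · rw [topologicalKrullDim_coe_eq_height, h2]; rfl

/-- The dimension of a family whose generic member has codimension two in its fibre. -/
theorem codim_two (ψ : ChartInvolution D.o) (b : σ → ℂ) (K : Finset κ)
    (hK : LinearIndepOn ℂ (fun k => D.col k (D.base b)) (K : Set κ))
    (hrank : ∀ x, Module.finrank ℂ
      (Submodule.span ℂ (Set.range fun k => D.col k (D.base x))) ≤ K.card)
    {u v : σ → ℂ} (huT : ∀ s ∉ D.T, u s = 0) (hvT : ∀ s ∉ D.T, v s = 0)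
    (hu : u ∉ Submodule.span ℂ (Set.range fun k => D.col k (D.base b)))
    (hv : v ∉ Submodule.span ℂ (insert u (Set.range fun k => D.col k (D.base b))))
    (B : Finset σ) (hB : ∀ s ∈ B, s ∉ D.T ∧ s ≠ D.o) {n : ℕ} (hn : B.card + K.card = n)
    (hσ : Nat.card σ = n + 3) :
    topologicalKrullDim (ProjSpace σ) = ((n + 2 : ℕ) : WithBot ℕ∞) ∧
    topologicalKrullDim ↥(D.totalClosure ψ : Set (ProjSpace σ)) = (n : WithBot ℕ∞) := by
  classical
  have : Nonempty σ := ⟨D.o⟩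
  -- The family enlarged by the constant column `u` has a closure strictly between that of `D` and
  -- the whole space: `u` separates it from `D`, and `v` separates it from the ambient space.
  let E := D.addColumn u huT
  have hrange : ∀ x, (Set.range fun i => E.col i (E.base x)) =
      insert u (Set.range fun k => D.col k (D.base x)) := by
    intro x
    ext y
    simp only [Set.mem_range, Option.exists, Set.mem_insert_iff]
    exact or_congr_left eq_comm
  have hKE : LinearIndepOn ℂ (fun i => E.col i (E.base b)) (Finset.insertNone K : Set (Option κ)) := by
    have hset : ((Finset.insertNone K : Finset (Option κ)) : Set (Option κ)) =
        insert none (some '' (K : Set κ)) := by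
      ext (_ | k) <;> simp
    rw [hset, linearIndepOn_insert (by simp)]
    refine ⟨?_, fun hmem => hu (Submodule.span_mono ?_ hmem)⟩
    · exact hK.image_of_comp (f := some) (g := fun i => E.col i (E.base b))
    · rintro _ ⟨_, ⟨k, _, rfl⟩, rfl⟩
      exact ⟨k, rfl⟩
  have hrankE : ∀ x, Module.finrank ℂ
      (Submodule.span ℂ (Set.range fun i => E.col i (E.base x))) ≤ (Finset.insertNone K).card := by
    intro x
    rw [hrange, Finset.card_insertNone, Submodule.span_insert]
    refine (Submodule.finrank_add_le_finrank_add_finrank _ _).trans ?_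
    rw [add_comm]
    exact add_le_add (hrank x) ((finrank_span_le_card {u}).trans (by simp))
  have h0 := E.toFun_ne_zero ψ (E.base_add_o b hvT)
  have hx := E.mk_notMem_totalClosure ψ b _ hKE hrankE hvT (by rwa [hrange]) h0
  have h0' := D.toFun_ne_zero ψ (D.base_add_o b huT)
  have hx' := D.mk_notMem_totalClosure ψ b K hK hrank huT hu h0'
  have hlt : D.totalClosure ψ < E.totalClosure ψ := by
    refine lt_of_le_of_ne (closure_mono (ofVectors_mono (Set.image_mono
      (D.total_subset_total_addColumn u huT)))) fun heq => hx' ?_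
    rw [heq]
    exact subset_closure (mk_mem_ofVectors
      (Set.mem_image_of_mem _ (D.base_add_mem_total_addColumn u huT b)) h0')
  have h1 := D.card_add_card_le_height_totalClosure ψ b K hK B hB
  rw [hn] at h1
  have h4 := Order.height_add_one_le hlt
  have h5 := Order.height_add_one_le (lt_univIrreducible hx)
  have h6 := height_le_of_card (univIrreducible (σ := σ)) hσ
  have h7 : ((n + 1 : ℕ) : ℕ∞) ≤ Order.height (E.totalClosure ψ) := by
    refine le_trans ?_ h4
    push_cast
    gcongr
  obtain ⟨h8, h9⟩ := ENat.eq_of_chain_one h7 h5 h6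
  obtain ⟨h10, -⟩ := ENat.eq_of_chain_one h1 h4 h8.le
  refine ⟨?_, ?_⟩
  · rw [topologicalKrullDim_eq_height_univIrreducible, h9]; rfl
  · rw [topologicalKrullDim_coe_eq_height, h10]; rfl

end LinearFamily

end

/-! ### Truncated power series, inversion, and the Padé equations. -/

section

open TopologicalSpace

theorem MvPolynomial.totalDegree_le_iff_coeff {σ R : Type*} [CommSemiring R]
    {p : MvPolynomial σ R} {d : ℕ} :
    p.totalDegree ≤ d ↔ ∀ γ : σ →₀ ℕ, d < γ.degree → p.coeff γ = 0 := by
  rw [MvPolynomial.totalDegree, Finset.sup_le_iff]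
  refine forall_congr' fun γ => ?_
  rw [MvPolynomial.mem_support_iff, ← not_imp_not, not_le, not_not]
  rfl

namespace TaylorIndex

variable {n m : ℕ}

instance : Finite (TaylorIndex n m) := Finsupp.finite_of_degree_le m

noncomputable instance : Fintype (TaylorIndex n m) := Fintype.ofFinite _

/-- The index of the constant term. -/
def zero : TaylorIndex n m := ⟨0, by simp⟩

/-- The vector of coefficients of degree at most `m` of a power series. -/
noncomputable def coeffVec (m : ℕ) :
    MvPowerSeries (Fin n) ℂ →ₗ[ℂ] (TaylorIndex n m → ℂ) :=
  LinearMap.pi fun γ => MvPowerSeries.coeff γ.1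

/-- The polynomial with a given vector of coefficients, as a power series. -/
noncomputable def series (x : TaylorIndex n m → ℂ) : MvPowerSeries (Fin n) ℂ :=
  fun γ => if h : γ.degree ≤ m then x ⟨γ, h⟩ else 0

theorem coeffVec_apply (φ : MvPowerSeries (Fin n) ℂ) (γ : TaylorIndex n m) :
    coeffVec m φ γ = MvPowerSeries.coeff γ.1 φ := rfl

theorem coeff_series (x : TaylorIndex n m → ℂ) (γ : Fin n →₀ ℕ) :
    MvPowerSeries.coeff γ (series x) = if h : γ.degree ≤ m then x ⟨γ, h⟩ else 0 := rfl

theorem taylorCoeffs_eq (P Q : MvPolynomial (Fin n) ℂ) : taylorCoeffs m P Q =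
    coeffVec m ((P : MvPowerSeries (Fin n) ℂ) * (Q : MvPowerSeries (Fin n) ℂ)⁻¹) := rfl

theorem coeffVec_series (x : TaylorIndex n m → ℂ) : coeffVec m (series x) = x := by
  funext γ
  rw [coeffVec_apply, coeff_series, dif_pos γ.2]

theorem coeffVec_eq_iff {φ χ : MvPowerSeries (Fin n) ℂ} :
    coeffVec m φ = coeffVec m χ ↔
      ∀ γ : Fin n →₀ ℕ, γ.degree ≤ m → MvPowerSeries.coeff γ φ = MvPowerSeries.coeff γ χ :=
  ⟨fun h γ hγ => congrFun h ⟨γ, hγ⟩, fun h => funext fun γ => h γ.1 γ.2⟩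

theorem coeffVec_mul_congr {φ φ' : MvPowerSeries (Fin n) ℂ} (h : coeffVec m φ = coeffVec m φ')
    (χ : MvPowerSeries (Fin n) ℂ) : coeffVec m (φ * χ) = coeffVec m (φ' * χ) := by
  classical
  rw [coeffVec_eq_iff] at h ⊢
  intro γ hγ
  rw [MvPowerSeries.coeff_mul, MvPowerSeries.coeff_mul]
  refine Finset.sum_congr rfl fun p hp => ?_
  have hle : p.1 ≤ γ := by
    rw [← Finset.HasAntidiagonal.mem_antidiagonal.1 hp]
    exact le_self_add
  rw [h p.1 ((Finsupp.degree_mono hle).trans hγ)]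

theorem constantCoeff_series (x : TaylorIndex n m → ℂ) :
    MvPowerSeries.constantCoeff (series x) = x zero := by
  rw [← MvPowerSeries.coeff_zero_eq_constantCoeff_apply, coeff_series, dif_pos (by simp)]
  rfl

theorem coeffVec_zero_eq (φ : MvPowerSeries (Fin n) ℂ) :
    coeffVec m φ zero = MvPowerSeries.constantCoeff φ := by
  rw [← MvPowerSeries.coeff_zero_eq_constantCoeff_apply]
  rfl

/-- Multiply the congruence of `φ` and `χ` by the product of both inverses. -/
theorem coeffVec_invOfUnit_congr {φ χ : MvPowerSeries (Fin n) ℂ} (h : coeffVec m φ = coeffVec m χ)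
    (hφ : MvPowerSeries.constantCoeff φ = 1) (hχ : MvPowerSeries.constantCoeff χ = 1) :
    coeffVec m (φ.invOfUnit 1) = coeffVec m (χ.invOfUnit 1) := by
  have h1 := MvPowerSeries.mul_invOfUnit φ 1 hφ
  have h2 := MvPowerSeries.mul_invOfUnit χ 1 hχ
  have h3 := coeffVec_mul_congr h (φ.invOfUnit 1 * χ.invOfUnit 1)
  rw [← mul_assoc, h1, one_mul, mul_comm (φ.invOfUnit 1), ← mul_assoc, h2, one_mul] at h3
  exact h3.symm

/-- The recursion for the inverse divides only by the constant term; `invOfUnit 1` replaces it by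
one, so that no denominators occur, even off the chart. -/
theorem isPolyFun_coeff_invOfUnit_series (γ : Fin n →₀ ℕ) :
    IsPolyFun fun x : TaylorIndex n m → ℂ => MvPowerSeries.coeff γ ((series x).invOfUnit 1) := by
  classical
  induction γ using WellFoundedLT.induction with
  | ind γ ih =>
    simp only [MvPowerSeries.coeff_invOfUnit γ]
    split_ifs
    · exact IsPolyFun.const _
    · refine (IsPolyFun.const _).mul (IsPolyFun.sum _ fun p _ => ?_)
      split_ifs with hp
      · refine IsPolyFun.mul ?_ (ih _ hp)
        simp only [coeff_series]
        split_ifs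
        · exact IsPolyFun.coord _
        · exact IsPolyFun.const _
      · exact IsPolyFun.const _

/-- Truncated inversion of power series with constant term one. -/
noncomputable def inversion (n m : ℕ) : ChartInvolution (zero : TaylorIndex n m) where
  toFun x := coeffVec m ((series x).invOfUnit 1)
  isPolyFun γ := isPolyFun_coeff_invOfUnit_series γ.1
  apply_base x _ := by simp [coeffVec_zero_eq]
  involutive x hx := by
    have hc : MvPowerSeries.constantCoeff (series x) = 1 := by rw [constantCoeff_series, hx]
    have h1 : coeffVec m (series (coeffVec m ((series x).invOfUnit 1))) =
        coeffVec m ((series x).invOfUnit 1) := coeffVec_series _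
    have h2 : MvPowerSeries.constantCoeff ((series x).invOfUnit 1) = 1 := by simp
    have h3 : MvPowerSeries.constantCoeff (series (coeffVec m ((series x).invOfUnit 1))) = 1 := by
      rw [constantCoeff_series, coeffVec_zero_eq, h2]
    rw [coeffVec_invOfUnit_congr h1 h3 h2]
    have h4 := MvPowerSeries.mul_invOfUnit _ 1 h2
    have h5 := MvPowerSeries.mul_invOfUnit _ 1 hc
    have h6 : ((series x).invOfUnit 1).invOfUnit 1 = series x := by
      calc ((series x).invOfUnit 1).invOfUnit 1 =
          (series x * (series x).invOfUnit 1) * ((series x).invOfUnit 1).invOfUnit 1 := by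
            rw [h5, one_mul]
        _ = series x := by rw [mul_assoc, h4, mul_one]
    rw [h6, coeffVec_series]

/-- The exponents of positive degree at most `e`. -/
abbrev PosIndex (n e : ℕ) : Type := {k : Fin n →₀ ℕ // 1 ≤ k.degree ∧ k.degree ≤ e}

instance (n e : ℕ) : Finite (PosIndex n e) :=
  Set.Finite.subset (Finsupp.finite_of_degree_le e) fun _ h => h.2

noncomputable instance (n e : ℕ) : Fintype (PosIndex n e) := Fintype.ofFinite _

/-- The coefficients of degree `m` of a power series, extended by zero. -/
noncomputable def topPart (m : ℕ) : MvPowerSeries (Fin n) ℂ →ₗ[ℂ] (TaylorIndex n m → ℂ) :=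
  LinearMap.pi fun γ => if γ.1.degree = m then MvPowerSeries.coeff γ.1 else 0

theorem topPart_apply (φ : MvPowerSeries (Fin n) ℂ) (γ : TaylorIndex n m) :
    topPart m φ γ = if γ.1.degree = m then MvPowerSeries.coeff γ.1 φ else 0 := by
  simp only [topPart, LinearMap.pi_apply]
  split_ifs <;> rfl

/-- The columns of the Padé matrix of rows of degree `d + 1`. -/
noncomputable def family (n d e : ℕ) : LinearFamily (TaylorIndex n (d + 1)) (PosIndex n e) where
  o := zero
  T := {γ | γ.1.degree = d + 1}
  o_notMem := by simp [zero]
  col k x := topPart (d + 1) (MvPowerSeries.monomial k.1 1 * series x)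
  isPolyFun_col k γ := by
    simp only [topPart_apply, MvPowerSeries.coeff_monomial_mul, coeff_series]
    split_ifs
    · exact (IsPolyFun.const _).mul (IsPolyFun.coord _)
    · exact (IsPolyFun.const _).mul (IsPolyFun.const _)
    · exact IsPolyFun.const _
    · exact IsPolyFun.const _
  col_eq_zero k x γ hγ := by
    rw [topPart_apply, if_neg (show ¬γ.1.degree = d + 1 from hγ)]

variable {d e : ℕ}

/-- Since `|k| ≥ 1`, a coefficient of `x^k F` in degree `d + 1` involves no coefficient of `F` in
that degree, so erasing the top part changes nothing. -/
theorem family_col_base (k : PosIndex n e) (x : TaylorIndex n (d + 1) → ℂ)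
    (hx : x zero = 1) :
    (family n d e).col k ((family n d e).base x) = (family n d e).col k x := by
  funext γ
  change topPart _ _ γ = topPart _ _ γ
  rw [topPart_apply, topPart_apply]
  split_ifs with hγ
  swap
  · rfl
  rw [MvPowerSeries.coeff_monomial_mul, MvPowerSeries.coeff_monomial_mul]
  split_ifs with hk
  swap
  · rfl
  congr 1
  rw [coeff_series, coeff_series]
  split_ifs with hd
  swap
  · rfl
  by_cases h0 : (⟨γ.1 - k.1, hd⟩ : TaylorIndex n (d + 1)) = zero
  · rw [h0, hx]
    exact (family n d e).base_o x
  · refine (family n d e).base_of_notMem x ?_ h0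
    intro hmem
    change (γ.1 - k.1).degree = d + 1 at hmem
    have h1 := k.2.1
    have h2 : (γ.1 - k.1).degree + k.1.degree = γ.1.degree := by
      rw [← map_add, tsub_add_cancel_of_le hk]
    omega

/-- The denominator with prescribed coefficients of positive degree. -/
noncomputable def denominator (q : PosIndex n e → ℂ) : MvPolynomial (Fin n) ℂ :=
  1 - ∑ k, MvPolynomial.monomial k.1 (q k)

theorem sum_col (q : PosIndex n e → ℂ) (x : TaylorIndex n (d + 1) → ℂ) :
    ∑ k, q k • (family n d e).col k x =
      topPart (d + 1) (series x - (denominator q : MvPowerSeries (Fin n) ℂ) * series x) := by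
  have h : (denominator q : MvPowerSeries (Fin n) ℂ) =
      1 - ∑ k : PosIndex n e, q k • MvPowerSeries.monomial k.1 1 := by
    have hc : ∀ p : MvPolynomial (Fin n) ℂ,
        (p : MvPowerSeries (Fin n) ℂ) = MvPolynomial.coeToMvPowerSeries.ringHom p := fun _ => rfl
    rw [denominator, hc, map_sub, map_one, map_sum]
    congr 1
    refine Finset.sum_congr rfl fun k _ => ?_
    rw [← hc, MvPolynomial.coe_monomial, ← map_smul, smul_eq_mul, mul_one]
  rw [h, sub_mul, one_mul, sub_sub_cancel, Finset.sum_mul, map_sum]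
  refine Finset.sum_congr rfl fun k _ => ?_
  rw [smul_mul_assoc, map_smul]
  rfl

/-- The top part of `Q * F` is the top part of `F` minus the combination of columns with
coefficients `q`, so its vanishing is exactly the parametrization equation. -/
theorem mem_total_family {x : TaylorIndex n (d + 1) → ℂ} :
    x ∈ (family n d e).total ↔ x zero = 1 ∧ ∃ q : PosIndex n e → ℂ,
      topPart (d + 1) ((denominator q : MvPowerSeries (Fin n) ℂ) * series x) = 0 := by
  have key : ∀ (x : TaylorIndex n (d + 1) → ℂ) (q : PosIndex n e → ℂ), x zero = 1 →
      ((family n d e).param x q = x ↔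
        topPart (d + 1) ((denominator q : MvPowerSeries (Fin n) ℂ) * series x) = 0) := by
    intro x q hx
    have hx' : x = (family n d e).base x + topPart (d + 1) (series x) := by
      funext γ
      rw [Pi.add_apply, topPart_apply]
      split_ifs with hγ
      · rw [(family n d e).base_of_mem x hγ, zero_add, coeff_series, dif_pos γ.2]
      · rw [add_zero]
        by_cases h0 : γ = zero
        · rw [h0, hx]
          exact ((family n d e).base_o x).symm
        · exact ((family n d e).base_of_notMem x hγ h0).symm
    rw [LinearFamily.param, Finset.sum_congr rfl fun k _ => by rw [family_col_base k x hx],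
      sum_col, map_sub]
    conv_lhs => rhs; rw [hx']
    rw [add_right_inj, sub_eq_self]
  constructor
  · rintro ⟨⟨y, q⟩, rfl⟩
    have h1 : (family n d e).param y q zero = 1 := (family n d e).param_o y q
    refine ⟨h1, q, (key _ _ h1).1 ?_⟩
    -- `param` sees its first argument only through `base`, so applying it again with the same `q`
    -- has no effect.
    exact congrArg (fun z => z + ∑ k, q k • (family n d e).col k z)
      ((family n d e).base_param y q)
  · rintro ⟨hx, q, hq⟩
    exact ⟨(x, q), (key x q hx).2 hq⟩

theorem coeff_denominator (q : PosIndex n e → ℂ) (γ : Fin n →₀ ℕ) :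
    (denominator q).coeff γ =
      if γ = 0 then 1 else if h : 1 ≤ γ.degree ∧ γ.degree ≤ e then -q ⟨γ, h⟩ else 0 := by
  classical
  rw [denominator, MvPolynomial.coeff_sub, MvPolynomial.coeff_one, MvPolynomial.coeff_sum]
  simp only [MvPolynomial.coeff_monomial]
  by_cases h0 : γ = 0
  · subst h0
    have : ∀ k : PosIndex n e, k.1 ≠ 0 := fun k hk => by
      have := k.2.1
      rw [hk] at this
      simp at this
    simp [this]
  · rw [if_neg h0, if_neg (Ne.symm h0), zero_sub]
    split_ifs with h
    · rw [Finset.sum_eq_single ⟨γ, h⟩]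
      · simp
      · intro k _ hk
        exact if_neg fun hkγ => hk (Subtype.ext hkγ)
      · simp
    · rw [neg_eq_zero]
      refine Finset.sum_eq_zero fun k _ => if_neg fun hkγ => h ?_
      rw [← hkγ]
      exact k.2

theorem totalDegree_denominator (q : PosIndex n e → ℂ) : (denominator q).totalDegree ≤ e := by
  rw [MvPolynomial.totalDegree_le_iff_coeff]
  intro γ hγ
  rw [coeff_denominator, if_neg, dif_neg]
  · omega
  · rintro rfl
    simp at hγ

theorem constantCoeff_denominator (q : PosIndex n e → ℂ) :
    MvPolynomial.constantCoeff (denominator q) = 1 := by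
  rw [MvPolynomial.constantCoeff_eq, coeff_denominator, if_pos rfl]

theorem eq_denominator {Q : MvPolynomial (Fin n) ℂ} (hQ : Q.totalDegree ≤ e)
    (hQ0 : MvPolynomial.constantCoeff Q = 1) :
    Q = denominator fun k : PosIndex n e => -Q.coeff k.1 := by
  ext γ
  rw [coeff_denominator]
  split_ifs with h0 h
  · rw [h0, ← MvPolynomial.constantCoeff_eq, hQ0]
  · rw [neg_neg]
  · refine MvPolynomial.totalDegree_le_iff_coeff.1 hQ γ ?_
    have := (Finsupp.degree_eq_zero_iff γ).not.2 h0
    omega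

theorem constantCoeff_coe (P : MvPolynomial (Fin n) ℂ) :
    MvPowerSeries.constantCoeff (P : MvPowerSeries (Fin n) ℂ) =
      MvPolynomial.constantCoeff P := by
  rw [← MvPowerSeries.coeff_zero_eq_constantCoeff_apply, MvPolynomial.coeff_coe]
  rfl

/-- The affine cone description of the Taylor points: a truncated power series is the Taylor
polynomial of a fraction exactly when it satisfies the linear equations of Padé approximation. -/
theorem total_family_eq : (family n d e).total =
    {x | ∃ P Q : MvPolynomial (Fin n) ℂ, P.totalDegree ≤ d ∧ Q.totalDegree ≤ e ∧
      MvPolynomial.constantCoeff P = 1 ∧ MvPolynomial.constantCoeff Q = 1 ∧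
      x = taylorCoeffs (d + 1) P Q} := by
  ext x
  rw [mem_total_family]
  constructor
  · rintro ⟨hx, q, hq⟩
    -- The numerator is `φ` cut off: `truncTotal (d + 1)` keeps the degrees strictly below `d + 1`,
    -- and the degree `d + 1` part of `φ` vanishes by `hq`.
    set φ := (denominator q : MvPowerSeries (Fin n) ℂ) * series x with hφ
    have hQ0 : MvPowerSeries.constantCoeff (denominator q : MvPowerSeries (Fin n) ℂ) = 1 := by
      rw [constantCoeff_coe, constantCoeff_denominator]
    have hP : coeffVec (d + 1) (φ.truncTotal (d + 1) : MvPowerSeries (Fin n) ℂ) =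
        coeffVec (d + 1) φ := by
      rw [coeffVec_eq_iff]
      intro γ hγ
      rw [MvPolynomial.coeff_coe, MvPowerSeries.coeff_truncTotal_eq_ite]
      split_ifs with h
      · rfl
      · have := congrFun hq ⟨γ, hγ⟩
        rw [topPart_apply, if_pos (by change γ.degree = d + 1; omega)] at this
        exact this.symm
    refine ⟨φ.truncTotal (d + 1), denominator q, ?_, totalDegree_denominator q, ?_,
      constantCoeff_denominator q, ?_⟩
    · rw [MvPolynomial.totalDegree_le_iff_coeff]
      intro γ hγ
      exact MvPowerSeries.coeff_truncTotal_eq_zero _ hγ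
    · rw [MvPowerSeries.constantCoeff_truncTotal_eq_ite, if_pos d.succ_pos, hφ, map_mul, hQ0,
        constantCoeff_series, hx, one_mul]
    · rw [taylorCoeffs_eq, coeffVec_mul_congr hP, hφ, mul_comm (denominator q : MvPowerSeries (Fin n) ℂ), mul_assoc,
        MvPowerSeries.mul_inv_cancel _ (by rw [hQ0]; exact one_ne_zero), mul_one, coeffVec_series]
  · rintro ⟨P, Q, hP, hQ, hP0, hQ0, rfl⟩
    have hQ0' : MvPowerSeries.constantCoeff (Q : MvPowerSeries (Fin n) ℂ) ≠ 0 := by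
      rw [constantCoeff_coe, hQ0]; exact one_ne_zero
    refine ⟨?_, fun k => -Q.coeff k.1, ?_⟩
    · rw [taylorCoeffs_eq, coeffVec_zero_eq, map_mul, MvPowerSeries.constantCoeff_inv, constantCoeff_coe,
        constantCoeff_coe, hP0, hQ0]
      simp
    · rw [← eq_denominator hQ hQ0]
      have h1 : coeffVec (d + 1) (series (taylorCoeffs (d + 1) P Q)) =
          coeffVec (d + 1) ((P : MvPowerSeries (Fin n) ℂ) * (Q : MvPowerSeries (Fin n) ℂ)⁻¹) :=
        coeffVec_series _
      have h2 := coeffVec_mul_congr h1 (Q : MvPowerSeries (Fin n) ℂ)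
      rw [mul_assoc, MvPowerSeries.inv_mul_cancel _ hQ0', mul_one, coeffVec_eq_iff] at h2
      funext γ
      rw [topPart_apply]
      split_ifs with hγ
      · rw [mul_comm, h2 _ γ.2, MvPolynomial.coeff_coe, Pi.zero_apply]
        exact MvPolynomial.totalDegree_le_iff_coeff.1 hP _ (by omega)
      · rfl

theorem taylorPoints_eq : taylorPoints n d e (d + 1) =
    ProjSpace.ofVectors (family n d e).total := by
  rw [total_family_eq]
  ext x
  constructor
  · rintro ⟨P, Q, hP, hQ, hP0, hQ0, h, rfl⟩
    exact ⟨_, ⟨P, Q, hP, hQ, hP0, hQ0, rfl⟩, h, rfl⟩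
  · rintro ⟨_, ⟨P, Q, hP, hQ, hP0, hQ0, rfl⟩, h, rfl⟩
    exact ⟨P, Q, hP, hQ, hP0, hQ0, h, rfl⟩

theorem inversion_taylorCoeffs {m : ℕ} {P Q : MvPolynomial (Fin n) ℂ}
    (hP : MvPolynomial.constantCoeff P = 1) (hQ : MvPolynomial.constantCoeff Q = 1) :
    (inversion n m).toFun (taylorCoeffs m P Q) = taylorCoeffs m Q P := by
  have hP' : MvPowerSeries.constantCoeff (P : MvPowerSeries (Fin n) ℂ) = 1 := by
    rw [constantCoeff_coe, hP]
  have hQ' : MvPowerSeries.constantCoeff (Q : MvPowerSeries (Fin n) ℂ) = 1 := by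
    rw [constantCoeff_coe, hQ]
  have h1 : coeffVec m (series (taylorCoeffs m P Q)) =
      coeffVec m ((P : MvPowerSeries (Fin n) ℂ) * (Q : MvPowerSeries (Fin n) ℂ)⁻¹) :=
    coeffVec_series _
  have h2 : MvPowerSeries.constantCoeff
      ((P : MvPowerSeries (Fin n) ℂ) * (Q : MvPowerSeries (Fin n) ℂ)⁻¹) = 1 := by
    rw [map_mul, MvPowerSeries.constantCoeff_inv, hP', hQ']
    simp
  have h3 : MvPowerSeries.constantCoeff (series (taylorCoeffs m P Q)) = 1 := by
    rw [constantCoeff_series, ← h2, ← coeffVec_zero_eq (m := m)]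
    rfl
  rw [taylorCoeffs_eq Q P]
  change coeffVec m _ = coeffVec m _
  rw [coeffVec_invOfUnit_congr h1 h3 h2]
  congr 1
  rw [MvPowerSeries.invOfUnit_eq' _ 1 (by rw [h2]; rfl), MvPowerSeries.inv_eq_iff_mul_eq_one
    (by rw [h2]; exact one_ne_zero)]
  have h4 := MvPowerSeries.mul_inv_cancel _ (by rw [hP']; exact one_ne_zero :
    MvPowerSeries.constantCoeff (P : MvPowerSeries (Fin n) ℂ) ≠ 0)
  have h5 := MvPowerSeries.mul_inv_cancel _ (by rw [hQ']; exact one_ne_zero :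
    MvPowerSeries.constantCoeff (Q : MvPowerSeries (Fin n) ℂ) ≠ 0)
  calc _ = ((P : MvPowerSeries (Fin n) ℂ) * (P : MvPowerSeries (Fin n) ℂ)⁻¹) *
        ((Q : MvPowerSeries (Fin n) ℂ) * (Q : MvPowerSeries (Fin n) ℂ)⁻¹) := by ring
    _ = 1 := by rw [h4, h5, one_mul]

/-- This handles denominator degree `d` in truncation degree `d + 1`, where the numerator degree `e`
need not be one below the truncation degree. -/
theorem taylorPoints_swap_eq : taylorPoints n e d (d + 1) =
    ProjSpace.ofVectors ((inversion n (d + 1)).toFun '' (family n d e).total) := by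
  rw [total_family_eq]
  ext x
  constructor
  · rintro ⟨P, Q, hP, hQ, hP0, hQ0, h, rfl⟩
    exact ⟨_, ⟨_, ⟨Q, P, hQ, hP, hQ0, hP0, rfl⟩, inversion_taylorCoeffs hQ0 hP0⟩, h, rfl⟩
  · rintro ⟨_, ⟨_, ⟨P, Q, hP, hQ, hP0, hQ0, rfl⟩, rfl⟩, h, rfl⟩
    have := inversion_taylorCoeffs (m := d + 1) hP0 hQ0
    exact ⟨Q, P, hQ, hP, hQ0, hP0, this ▸ h, by simp only [this]; rfl⟩

theorem taylorVariety_eq : taylorVariety n d e (d + 1) =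
    ((family n d e).totalClosure (ChartInvolution.refl _) : Set (ProjSpace _)) := by
  rw [taylorVariety, taylorPoints_eq]
  change _ = closure (ProjSpace.ofVectors (id '' _))
  rw [Set.image_id]

theorem taylorVariety_swap_eq : taylorVariety n e d (d + 1) =
    ((family n d e).totalClosure (inversion n (d + 1)) : Set (ProjSpace _)) := by
  rw [taylorVariety, taylorPoints_swap_eq]
  rfl

end TaylorIndex

end

/-! ### The forced relation among the Padé columns, and counting monomials. -/

section

open TopologicalSpace

namespace TaylorIndex

variable {n : ℕ}

/-- The coefficients of `F_a - F_{a+1}` give a relation, because `F_a F_{a+1}` appears twice with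
opposite signs in degree `2a + 1`. -/
theorem finrank_span_col_lt {a : ℕ} (ha : 1 ≤ a) (i : Fin n) (x : TaylorIndex n (2 * a + 1) → ℂ) :
    Module.finrank ℂ (Submodule.span ℂ (Set.range fun k => (family n (2 * a) (a + 1)).col k x)) <
      Fintype.card (PosIndex n (a + 1)) := by
  classical
  have hrel : ∃ c : PosIndex n (a + 1) → ℂ, c ≠ 0 ∧
      ∑ k, c k • (family n (2 * a) (a + 1)).col k x = 0 := by
    let s : ℕ → ℂ := fun j => if j = a then 1 else if j = a + 1 then -1 else 0
    let c : PosIndex n (a + 1) → ℂ := fun k => s k.1.degree * MvPowerSeries.coeff k.1 (series x)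
    -- The relation may be trivial. Then `F_a = 0`, and any column of degree `a + 1` vanishes, as
    -- only `F_a` contributes to it.
    by_cases hc : c = 0
    · have hx : ∀ γ : Fin n →₀ ℕ, γ.degree = a → MvPowerSeries.coeff γ (series x) = 0 := by
        intro γ hγ
        simpa [c, s, hγ] using congrFun hc ⟨γ, by omega, by omega⟩
      obtain ⟨k₀, hk₀⟩ : ∃ k₀ : PosIndex n (a + 1), k₀.1.degree = a + 1 :=
        ⟨⟨Finsupp.single i (a + 1), by simp⟩, by simp⟩
      refine ⟨Pi.single k₀ 1, by simp, ?_⟩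
      rw [Finset.sum_eq_single k₀]
      · rw [Pi.single_eq_same, one_smul]
        funext γ
        change topPart _ _ γ = 0
        rw [topPart_apply, MvPowerSeries.coeff_monomial_mul]
        split_ifs with hγ hle
        · rw [hx, mul_zero]
          have h2 := congrArg Finsupp.degree (tsub_add_cancel_of_le hle)
          rw [map_add, hk₀] at h2
          omega
        · rfl
        · rfl
      · intro k _ hk
        rw [Pi.single_eq_of_ne hk, zero_smul]
      · simp
    · refine ⟨c, hc, ?_⟩
      rw [sum_col]
      funext γ
      rw [topPart_apply]
      split_ifs with hγ
      swap
      · rfl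
      have hcoeff : ∀ p : Fin n →₀ ℕ, MvPowerSeries.coeff p
          (1 - (denominator c : MvPowerSeries (Fin n) ℂ)) =
            s p.degree * MvPowerSeries.coeff p (series x) := by
        intro p
        rw [map_sub, MvPolynomial.coeff_coe, coeff_denominator, MvPowerSeries.coeff_one]
        split_ifs with h0 h
        · have : s p.degree = 0 := by
            rw [h0, map_zero]
            simp only [s]
            rw [if_neg (by omega), if_neg (by omega)]
          rw [this]; simp
        · simp [c]
        · have : s p.degree = 0 := by
            have := (Finsupp.degree_eq_zero_iff p).not.2 h0
            simp only [s]
            rw [if_neg (by omega), if_neg (by omega)]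
          rw [this]; simp
      -- For degrees adding up to `2a + 1`, one is `a` exactly when the other is `a + 1`. Exchanging
      -- the factors thus changes the sign of the convolution sum, which is therefore zero.
      have hs : ∀ p q : Fin n →₀ ℕ, p + q = γ.1 → s q.degree = -s p.degree := by
        intro p q hpq
        have h2 := congrArg Finsupp.degree hpq
        rw [map_add] at h2
        simp only [s]
        split_ifs <;> first | omega | simp
      rw [← one_sub_mul, MvPowerSeries.coeff_mul, Pi.zero_apply]
      rw [← self_eq_neg]
      refine (Finsupp.sum_antidiagonal_swap γ.1 fun p q => MvPowerSeries.coeff p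
        (1 - (denominator c : MvPowerSeries (Fin n) ℂ)) * MvPowerSeries.coeff q (series x)).trans ?_
      rw [← Finset.sum_neg_distrib]
      refine Finset.sum_congr rfl fun p hp => ?_
      rw [hcoeff, hcoeff,  hs p.1 p.2 (Finset.HasAntidiagonal.mem_antidiagonal.1 hp)]
      ring
  obtain ⟨c, hc0, hc⟩ := hrel
  refine lt_of_le_of_ne (finrank_range_le_card _) fun heq => hc0 ?_
  exact funext (Fintype.linearIndependent_iff.1
    (linearIndependent_iff_card_eq_finrank_span.2 heq.symm) c hc)

/-- Extract linearly independent columns from a lower bound on the span of all columns. -/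
theorem exists_linearIndepOn_col {a : ℕ} (ha : 1 ≤ a) (i : Fin n)
    (b : TaylorIndex n (2 * a + 1) → ℂ) (G : Finset (TaylorIndex n (2 * a + 1)))
    (hG : ∀ γ ∈ G, Pi.single γ 1 ∈ Submodule.span ℂ
      (Set.range fun k => (family n (2 * a) (a + 1)).col k ((family n (2 * a) (a + 1)).base b)))
    (hcard : G.card + 1 = Fintype.card (PosIndex n (a + 1))) :
    ∃ K : Finset (PosIndex n (a + 1)), K.card = G.card ∧ LinearIndepOn ℂ
      (fun k => (family n (2 * a) (a + 1)).col k ((family n (2 * a) (a + 1)).base b))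
        (K : Set (PosIndex n (a + 1))) ∧
      ∀ x, Module.finrank ℂ (Submodule.span ℂ (Set.range fun k =>
        (family n (2 * a) (a + 1)).col k ((family n (2 * a) (a + 1)).base x))) ≤ K.card := by
  classical
  set D := family n (2 * a) (a + 1)
  have hub : ∀ x, Module.finrank ℂ (Submodule.span ℂ
      (Set.range fun k => D.col k (D.base x))) ≤ G.card := fun x => by
    have : Module.finrank ℂ (Submodule.span ℂ (Set.range fun k => D.col k (D.base x))) < _ :=
      finrank_span_col_lt ha i (D.base x)
    omega
  obtain ⟨s, -, -, hspan, hLI⟩ := exists_linearIndepOn_extension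
    (linearIndepOn_empty ℂ fun k => D.col k (D.base b)) (Set.subset_univ _)
  have hK : LinearIndepOn ℂ (fun k => D.col k (D.base b)) (s.toFinset : Set (PosIndex n (a + 1))) := by
    rwa [Set.coe_toFinset]
  have hcardK : s.toFinset.card = G.card := by
    have h1 : Module.finrank ℂ (Submodule.span ℂ (Set.range fun k : s.toFinset =>
        D.col k.1 (D.base b))) = s.toFinset.card :=
      (finrank_span_eq_card hK).trans (Fintype.card_coe _)
    refine le_antisymm ?_ ?_
    · rw [← h1]
      refine (Submodule.finrank_mono (Submodule.span_mono ?_)).trans (hub b)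
      rintro _ ⟨k, rfl⟩
      exact ⟨k.1, rfl⟩
    · rw [← h1]
      have h2 : LinearIndependent ℂ fun γ : G => (Pi.single γ.1 1 : TaylorIndex n (2 * a + 1) → ℂ) := by
        simpa [Function.comp_def] using
          (Pi.basisFun ℂ (TaylorIndex n (2 * a + 1))).linearIndependent.comp (Subtype.val : G → _)
            Subtype.val_injective
      rw [← Fintype.card_coe, ← finrank_span_eq_card h2]
      refine Submodule.finrank_mono (Submodule.span_le.2 ?_)
      rintro _ ⟨γ, rfl⟩
      have h3 := hG γ.1 γ.2
      rw [← Set.image_univ] at h3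
      have h4 := Submodule.span_le.2 hspan h3
      refine Submodule.span_mono ?_ h4
      rintro _ ⟨k, hk, rfl⟩
      exact ⟨⟨k, Set.mem_toFinset.2 hk⟩, rfl⟩
  exact ⟨s.toFinset, hcardK, hK, fun x => (hub x).trans hcardK.ge⟩

/-- Stars and bars in each degree; the explicit sum lets the numerical cases be closed by
evaluation. -/
theorem exists_finset_degree (n M : ℕ) (p : ℕ → Prop) [DecidablePred p] :
    ∃ s : Finset (Fin n →₀ ℕ), (∀ γ, γ ∈ s ↔ γ.degree < M ∧ p γ.degree) ∧
      s.card = ∑ j ∈ (Finset.range M).filter p, (n + j - 1).choose j := by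
  classical
  refine ⟨((Finset.range M).filter p).biUnion fun j => Finset.univ.finsuppAntidiag j,
    fun γ => ?_, ?_⟩
  · simp [Finset.mem_finsuppAntidiag, ← Finsupp.degree_eq_sum]
  · rw [Finset.card_biUnion]
    · refine Finset.sum_congr rfl fun j _ => ?_
      rw [Finset.card_finsuppAntidiag_nat_eq_choose, Finset.card_univ, Fintype.card_fin]
    · intro j _ k _ hjk
      rw [Function.onFun, Finset.disjoint_left]
      intro γ h1 h2
      rw [Finset.mem_finsuppAntidiag] at h1 h2
      exact hjk (h1.1.symm.trans h2.1)

theorem card_filter_degree (n m : ℕ) (p : ℕ → Prop) [DecidablePred p] :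
    (Finset.univ.filter fun γ : TaylorIndex n m => p γ.1.degree).card =
      ∑ j ∈ (Finset.range (m + 1)).filter p, (n + j - 1).choose j := by
  classical
  obtain ⟨s, hs, hcard⟩ := exists_finset_degree n (m + 1) p
  rw [← hcard, ← Finset.card_map (Function.Embedding.subtype _)]
  congr 1
  ext γ
  rw [hs]
  simp [and_comm]

theorem card_posIndex (n e : ℕ) : Fintype.card (PosIndex n e) =
    ∑ j ∈ (Finset.range (e + 1)).filter (1 ≤ ·), (n + j - 1).choose j := by
  obtain ⟨s, hs, hcard⟩ := exists_finset_degree n (e + 1) (1 ≤ ·)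
  rw [← hcard, ← Nat.card_eq_fintype_card]
  refine Nat.subtype_card s fun γ => ?_
  rw [hs, Nat.lt_succ_iff, and_comm]

end TaylorIndex

end

/-! ### Explicit series attaining the maximal rank. -/

section

open TopologicalSpace

namespace TaylorIndex

theorem topPart_congr {n m : ℕ} {φ χ : MvPowerSeries (Fin n) ℂ} (h : coeffVec m φ = coeffVec m χ) :
    topPart m φ = topPart m χ := by
  funext γ
  rw [topPart_apply, topPart_apply, coeffVec_eq_iff.1 h _ γ.2]

theorem family_col_coeffVec {n d e : ℕ} (k : PosIndex n e) {F : MvPowerSeries (Fin n) ℂ}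
    (hF : MvPowerSeries.constantCoeff F = 1) :
    (family n d e).col k ((family n d e).base (coeffVec (d + 1) F)) =
      topPart (d + 1) (MvPowerSeries.monomial k.1 1 * F) := by
  rw [family_col_base _ _ (by rw [coeffVec_zero_eq, hF])]
  change topPart _ _ = _
  refine topPart_congr ?_
  rw [mul_comm, mul_comm _ F]
  exact coeffVec_mul_congr (coeffVec_series _) _

/-- The exponent of a monomial in three variables. -/
noncomputable def expo (a b c : ℕ) : Fin 3 →₀ ℕ := Finsupp.equivFunOnFinite.symm ![a, b, c]

theorem degree_expo (a b c : ℕ) : (expo a b c).degree = a + b + c := by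
  simp [expo, Finsupp.degree_eq_sum, Fin.sum_univ_three]

theorem expo_add (a b c a' b' c' : ℕ) :
    expo a b c + expo a' b' c' = expo (a + a') (b + b') (c + c') := by
  ext i
  fin_cases i <;> simp [expo]

theorem expo_inj {a b c a' b' c' : ℕ} :
    expo a b c = expo a' b' c' ↔ a = a' ∧ b = b' ∧ c = c' := by
  simp [expo]

theorem expo_zero : expo 0 0 0 = 0 := by
  ext i
  fin_cases i <;> simp [expo]

theorem exists_eq_expo (γ : Fin 3 →₀ ℕ) : ∃ a b c, γ = expo a b c :=
  ⟨γ 0, γ 1, γ 2, by ext i; fin_cases i <;> simp [expo]⟩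

/-- The coordinate vector of a monomial of degree `m` in three variables, and zero for monomials of
other degrees. -/
noncomputable def monoVec (m a b c : ℕ) : TaylorIndex 3 m → ℂ :=
  topPart m (MvPowerSeries.monomial (expo a b c) 1)

theorem monoVec_apply (m a b c : ℕ) (γ : TaylorIndex 3 m) :
    monoVec m a b c γ = if γ.1 = expo a b c ∧ γ.1.degree = m then 1 else 0 := by
  classical
  rw [monoVec, topPart_apply, MvPowerSeries.coeff_monomial, ← ite_and]
  simp only [and_comm]

theorem monoVec_of_ne {m a b c : ℕ} (h : a + b + c ≠ m) : monoVec m a b c = 0 := by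
  funext γ
  rw [monoVec_apply, if_neg]
  · rfl
  · rintro ⟨h1, h2⟩
    rw [h1, degree_expo] at h2
    exact h h2

theorem monoVec_eq_single {m a b c : ℕ} (h : a + b + c = m) [DecidableEq (TaylorIndex 3 m)] :
    monoVec m a b c = Pi.single ⟨expo a b c, by rw [degree_expo, h]⟩ 1 := by
  funext γ
  rw [monoVec_apply, Pi.single_apply]
  refine if_congr ⟨fun h => Subtype.ext h.1, ?_⟩ rfl rfl
  rintro rfl
  exact ⟨rfl, by rw [degree_expo, h]⟩

theorem monoVec_of_degree_ne {m a b c : ℕ} {γ : TaylorIndex 3 m} (hγ : γ.1.degree ≠ m) :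
    monoVec m a b c γ = 0 := by
  rw [monoVec_apply, if_neg fun h => hγ h.2]

theorem topPart_monomial_mul_monomial (m a b c a' b' c' : ℕ) :
    topPart m (MvPowerSeries.monomial (expo a b c) 1 * MvPowerSeries.monomial (expo a' b' c') 1) =
      monoVec m (a + a') (b + b') (c + c') := by
  rw [MvPowerSeries.monomial_mul_monomial, expo_add, mul_one, monoVec]

theorem constantCoeff_monomial_expo {a b c : ℕ} (h : a + b + c ≠ 0) :
    MvPowerSeries.constantCoeff (MvPowerSeries.monomial (expo a b c) (1 : ℂ)) = 0 := by
  classical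
  rw [← MvPowerSeries.coeff_zero_eq_constantCoeff_apply, MvPowerSeries.coeff_monomial, if_neg]
  intro h0
  rw [← expo_zero, expo_inj] at h0
  omega

/-- The power series `1 + x + y ^ 2`. -/
noncomputable def cubicSeries : MvPowerSeries (Fin 3) ℂ :=
  1 + MvPowerSeries.monomial (expo 1 0 0) 1 + MvPowerSeries.monomial (expo 0 2 0) 1

theorem constantCoeff_cubicSeries : MvPowerSeries.constantCoeff cubicSeries = 1 := by
  simp only [cubicSeries, map_add, map_one]
  simp [constantCoeff_monomial_expo]

theorem topPart_monomial_mul_cubicSeries {a b c : ℕ} (h : a + b + c ≤ 2) :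
    topPart 3 (MvPowerSeries.monomial (expo a b c) 1 * cubicSeries) =
      monoVec 3 (a + 1) b c + monoVec 3 a (b + 2) c := by
  simp only [cubicSeries, mul_add, mul_one, map_add, topPart_monomial_mul_monomial, add_zero]
  rw [← monoVec, monoVec_of_ne (by omega : a + b + c ≠ 3), zero_add]

/-- The power series `1 + x ^ 4 + y ^ 5 + z ^ 6 + (x y ^ 2 z ^ 4 + x ^ 3 y ^ 4) +
(x ^ 2 y z ^ 5 + x ^ 3 y ^ 2 z ^ 3 + x ^ 2 y ^ 4 z ^ 2)`. -/
noncomputable def nonicSeries : MvPowerSeries (Fin 3) ℂ :=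
  1 + MvPowerSeries.monomial (expo 4 0 0) 1 + MvPowerSeries.monomial (expo 0 5 0) 1 +
    MvPowerSeries.monomial (expo 0 0 6) 1 + MvPowerSeries.monomial (expo 1 2 4) 1 +
    MvPowerSeries.monomial (expo 3 4 0) 1 + MvPowerSeries.monomial (expo 2 1 5) 1 +
    MvPowerSeries.monomial (expo 3 2 3) 1 + MvPowerSeries.monomial (expo 2 4 2) 1

theorem constantCoeff_nonicSeries : MvPowerSeries.constantCoeff nonicSeries = 1 := by
  simp only [nonicSeries, map_add, map_one]
  simp [constantCoeff_monomial_expo]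

theorem topPart_monomial_mul_nonicSeries {a b c : ℕ} (h : a + b + c ≤ 5) :
    topPart 9 (MvPowerSeries.monomial (expo a b c) 1 * nonicSeries) =
      monoVec 9 (a + 4) b c + monoVec 9 a (b + 5) c + monoVec 9 a b (c + 6) +
      monoVec 9 (a + 1) (b + 2) (c + 4) + monoVec 9 (a + 3) (b + 4) c +
      monoVec 9 (a + 2) (b + 1) (c + 5) + monoVec 9 (a + 3) (b + 2) (c + 3) +
      monoVec 9 (a + 2) (b + 4) (c + 2) := by
  simp only [nonicSeries, mul_add, mul_one, map_add, topPart_monomial_mul_monomial, add_zero]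
  rw [← monoVec, monoVec_of_ne (by omega : a + b + c ≠ 9), zero_add]

section span

variable {V : Type*} [AddCommGroup V] [Module ℂ V] (S : Submodule ℂ V) (f : ℕ → ℕ → ℕ → V)

/-- The relations are the columns of `1 + x + y ^ 2`. Those of degree 2 give `x` times a quadratic
monomial, those of degree 1 give `y ^ 2` times a variable. The only coincidence, `x y ^ 2`, is the
forced relation; `z ^ 3` and `y z ^ 2` are missed. -/
theorem mem_of_cubic_relations (h0 : ∀ a b c, a + b + c ≠ 3 → f a b c = 0)
    (h : ∀ a b c, 1 ≤ a + b + c → a + b + c ≤ 2 → f (a + 1) b c + f a (b + 2) c ∈ S)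
    {a b c : ℕ} (habc : a + b + c = 3) (h1 : ¬(a = 0 ∧ b = 0)) (h2 : ¬(a = 0 ∧ b = 1)) :
    f a b c ∈ S := by
  rcases Nat.eq_zero_or_pos a with rfl | ha
  · obtain ⟨b, rfl⟩ : ∃ b', b = b' + 2 := ⟨b - 2, by omega⟩
    have := h 0 b c (by omega) (by omega)
    rwa [h0 _ _ _ (by omega), zero_add] at this
  · obtain ⟨a, rfl⟩ : ∃ a', a = a' + 1 := ⟨a - 1, by omega⟩
    have := h a b c (by omega) (by omega)
    rwa [h0 a _ _ (by omega), add_zero] at this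

/-- Columns of degree 5, 4, 3 give the multiples of `x ^ 4`, `y ^ 5`, `z ^ 6`, with `x ^ 4 y ^ 5`
obtained twice, as the forced relation requires. Ten monomials of degree 9 remain. The six columns
of degree 2 and the three of degree 1 each produce one new monomial modulo those already found,
which leaves out only `y ^ 4 z ^ 5`. -/
theorem mem_of_nonic_relations (h0 : ∀ a b c, a + b + c ≠ 9 → f a b c = 0)
    (h : ∀ a b c, 1 ≤ a + b + c → a + b + c ≤ 5 →
      f (a + 4) b c + f a (b + 5) c + f a b (c + 6) + f (a + 1) (b + 2) (c + 4) +
      f (a + 3) (b + 4) c + f (a + 2) (b + 1) (c + 5) + f (a + 3) (b + 2) (c + 3) +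
      f (a + 2) (b + 4) (c + 2) ∈ S)
    {a b c : ℕ} (habc : a + b + c = 9) (h1 : ¬(a = 0 ∧ b = 4)) :
    f a b c ∈ S := by
  have hx : ∀ a b c, a + b + c = 5 → f (a + 4) b c ∈ S := by
    intro a b c hs
    have := h a b c (by omega) (by omega)
    rwa [h0 a (b + 5), h0 a b, h0 (a + 1), h0 (a + 3) (b + 4), h0 (a + 2) (b + 1),
      h0 (a + 3) (b + 2), h0 (a + 2) (b + 4), add_zero, add_zero, add_zero, add_zero, add_zero,
      add_zero, add_zero] at this <;> omega
  have hy : ∀ a b c, a + b + c = 4 → f a (b + 5) c ∈ S := by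
    intro a b c hs
    have := h a b c (by omega) (by omega)
    rwa [h0 (a + 4) b, h0 a b, h0 (a + 1), h0 (a + 3) (b + 4), h0 (a + 2) (b + 1),
      h0 (a + 3) (b + 2), h0 (a + 2) (b + 4), add_zero, add_zero, add_zero, add_zero, add_zero,
      add_zero, zero_add] at this <;> omega
  have hz : ∀ a b c, a + b + c = 3 → f a b (c + 6) ∈ S := by
    intro a b c hs
    have := h a b c (by omega) (by omega)
    rwa [h0 (a + 4) b, h0 a (b + 5), h0 (a + 1), h0 (a + 3) (b + 4), h0 (a + 2) (b + 1),
      h0 (a + 3) (b + 2), h0 (a + 2) (b + 4), add_zero, add_zero, add_zero, add_zero, add_zero,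
      zero_add, zero_add] at this <;> omega
  have h7 : ∀ a b c, a + b + c = 2 → f (a + 1) (b + 2) (c + 4) + f (a + 3) (b + 4) c ∈ S := by
    intro a b c hs
    have := h a b c (by omega) (by omega)
    rwa [h0 (a + 4) b, h0 a (b + 5), h0 a b, h0 (a + 2) (b + 1),
      h0 (a + 3) (b + 2), h0 (a + 2) (b + 4), add_zero, add_zero, add_zero, zero_add,
      zero_add, zero_add] at this <;> omega
  have h8 : ∀ a b c, a + b + c = 1 →
      f (a + 2) (b + 1) (c + 5) + f (a + 3) (b + 2) (c + 3) + f (a + 2) (b + 4) (c + 2) ∈ S := by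
    intro a b c hs
    have := h a b c (by omega) (by omega)
    rwa [h0 (a + 4) b, h0 a (b + 5), h0 a b, h0 (a + 1), h0 (a + 3) (b + 4), zero_add, zero_add,
      zero_add, zero_add, zero_add] at this <;> omega
  have h324 : f 3 2 4 ∈ S := (S.add_mem_iff_left (hx 1 4 0 rfl)).1 (h7 2 0 0 rfl)
  have h144 : f 1 4 4 ∈ S := (S.add_mem_iff_left (hy 3 1 0 rfl)).1 (h7 0 2 0 rfl)
  have h342 : f 3 4 2 ∈ S := (S.add_mem_iff_right (hz 1 2 0 rfl)).1 (h7 0 0 2 rfl)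
  have h234 : f 2 3 4 ∈ S := (S.add_mem_iff_left (hx 0 5 0 rfl)).1 (h7 1 1 0 rfl)
  have h225 : f 2 2 5 ∈ S := (S.add_mem_iff_left (hx 0 4 1 rfl)).1 (h7 1 0 1 rfl)
  have h135 : f 1 3 5 ∈ S := (S.add_mem_iff_left (hy 3 0 1 rfl)).1 (h7 0 1 1 rfl)
  have h315 : f 3 1 5 ∈ S := (S.add_mem_iff_left (hx 0 2 3 rfl)).1
    ((S.add_mem_iff_left h342).1 (h8 1 0 0 rfl))
  have h333 : f 3 3 3 ∈ S := (S.add_mem_iff_right h225).1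
    ((S.add_mem_iff_left (hy 2 0 2 rfl)).1 (h8 0 1 0 rfl))
  have h243 : f 2 4 3 ∈ S := (S.add_mem_iff_right (S.add_mem (hz 2 1 0 rfl) h324)).1
    (h8 0 0 1 rfl)
  by_cases ha : 4 ≤ a
  · obtain ⟨a, rfl⟩ : ∃ a', a = a' + 4 := ⟨a - 4, by omega⟩
    exact hx a b c (by omega)
  by_cases hb : 5 ≤ b
  · obtain ⟨b, rfl⟩ : ∃ b', b = b' + 5 := ⟨b - 5, by omega⟩
    exact hy a b c (by omega)
  by_cases hc : 6 ≤ c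
  · obtain ⟨c, rfl⟩ : ∃ c', c = c' + 6 := ⟨c - 6, by omega⟩
    exact hz a b c (by omega)
  push Not at ha hb hc
  have hc' : c = 9 - a - b := by omega
  subst hc'
  interval_cases a <;> interval_cases b <;> first | assumption | omega

end span

theorem card_taylorIndex (n m : ℕ) :
    Nat.card (TaylorIndex n m) = ∑ j ∈ Finset.range (m + 1), (n + j - 1).choose j := by
  have := card_filter_degree n m fun _ => True
  rw [Finset.filter_true, Finset.filter_true, Finset.card_univ] at this
  rw [Nat.card_eq_fintype_card, this]

theorem middle_notMem {n d e : ℕ} {γ : TaylorIndex n (d + 1)}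
    (hγ : γ ∈ Finset.univ.filter fun γ : TaylorIndex n (d + 1) =>
      1 ≤ γ.1.degree ∧ γ.1.degree ≤ d) :
    γ ∉ (family n d e).T ∧ γ ≠ (family n d e).o := by
  rw [Finset.mem_filter] at hγ
  refine ⟨fun h => ?_, ?_⟩
  · change γ.1.degree = d + 1 at h
    omega
  · rintro rfl
    have h : (0 : Fin n →₀ ℕ).degree = 0 := map_zero _
    have h1 : 1 ≤ (0 : Fin n →₀ ℕ).degree := hγ.2.1
    omega

/-- Arbitrary `ψ` lets the identity serve for `(8, 5)` and inversion for `(5, 8)`. -/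
theorem family_3_8_5 (ψ : ChartInvolution (zero : TaylorIndex 3 9)) :
    topologicalKrullDim (ProjSpace (TaylorIndex 3 9)) = 219 ∧
    topologicalKrullDim ↥((family 3 8 5).totalClosure ψ : Set (ProjSpace (TaylorIndex 3 9))) = 218 ∧
    ProjSpace.IsHypersurface ((family 3 8 5).totalClosure ψ : Set (ProjSpace (TaylorIndex 3 9))) := by
  classical
  set D := family 3 8 5
  set b : TaylorIndex 3 9 → ℂ := coeffVec 9 nonicSeries
  let μ : TaylorIndex 3 9 := ⟨expo 0 4 5, by rw [degree_expo]⟩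
  have hcol : ∀ {x y z : ℕ} (h : 1 ≤ (expo x y z).degree ∧ (expo x y z).degree ≤ 5),
      D.col ⟨expo x y z, h⟩ (D.base b) = _ := fun {x y z} h =>
    (family_col_coeffVec _ constantCoeff_nonicSeries).trans
      (topPart_monomial_mul_nonicSeries (by rw [degree_expo] at h; exact h.2))
  set S := Submodule.span ℂ (Set.range fun k => D.col k (D.base b))
  have hmem : ∀ {x y z : ℕ}, x + y + z = 9 → ¬(x = 0 ∧ y = 4) → monoVec 9 x y z ∈ S := by
    refine fun {x y z} => mem_of_nonic_relations S (monoVec 9) (fun _ _ _ => monoVec_of_ne) ?_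
    intro x y z h1 h2
    have h : 1 ≤ (expo x y z).degree ∧ (expo x y z).degree ≤ 5 := by
      rw [degree_expo]; exact ⟨h1, h2⟩
    rw [← hcol h]
    exact Submodule.subset_span ⟨_, rfl⟩
  -- No nonconstant monomial of `nonicSeries` divides `y ^ 4 z ^ 5`, so this coordinate vanishes on
  -- every column.
  have hnot : monoVec 9 0 4 5 ∉ S := by
    have hle : S ≤ LinearMap.ker (LinearMap.proj μ : (TaylorIndex 3 9 → ℂ) →ₗ[ℂ] ℂ) := by
      refine Submodule.span_le.2 ?_
      rintro _ ⟨⟨k, hk⟩, rfl⟩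
      obtain ⟨x, y, z, rfl⟩ := exists_eq_expo k
      simp only [hcol hk, SetLike.mem_coe, LinearMap.mem_ker, LinearMap.proj_apply, Pi.add_apply,
        monoVec_apply, μ, expo_inj]
      simp
    intro h
    have := LinearMap.mem_ker.1 (hle h)
    simp [monoVec_apply, μ, degree_expo] at this
  let G := (Finset.univ.filter fun γ : TaylorIndex 3 9 => γ.1.degree = 9).erase μ
  have hGcard : G.card = 54 := by
    rw [Finset.card_erase_of_mem (by simp [μ, degree_expo]), card_filter_degree 3 9 (· = 9)]
    rfl
  obtain ⟨K, hKG, hK, hrank⟩ := exists_linearIndepOn_col (a := 4) (by norm_num) (0 : Fin 3) b G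
    (by
      rintro ⟨γ, hγ9⟩ hγ
      rw [Finset.mem_erase, Finset.mem_filter] at hγ
      obtain ⟨x, y, z, rfl⟩ := exists_eq_expo γ
      have h9 : x + y + z = 9 := by rw [← degree_expo]; exact hγ.2.2
      rw [← monoVec_eq_single h9]
      refine hmem h9 fun h => hγ.1 (Subtype.ext (expo_inj.2 ?_))
      omega)
    (by rw [hGcard, card_posIndex]; rfl)
  exact D.codim_one ψ b K hK hrank (fun γ hγ => monoVec_of_degree_ne hγ) hnot
    -- There are 164 free coefficients of degrees 1 to 8, and 164 + 54 = 218.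
    (Finset.univ.filter fun γ : TaylorIndex 3 9 => 1 ≤ γ.1.degree ∧ γ.1.degree ≤ 8)
    (fun _ => middle_notMem) (n := 218)
    (by rw [card_filter_degree 3 9 fun j => 1 ≤ j ∧ j ≤ 8, hKG, hGcard]; rfl)
    (by rw [card_taylorIndex]; rfl)

theorem family_3_2_2 (ψ : ChartInvolution (zero : TaylorIndex 3 3)) :
    topologicalKrullDim (ProjSpace (TaylorIndex 3 3)) = 19 ∧
    topologicalKrullDim
      ↥((family 3 2 2).totalClosure ψ : Set (ProjSpace (TaylorIndex 3 3))) = 17 := by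
  classical
  set D := family 3 2 2
  set b : TaylorIndex 3 3 → ℂ := coeffVec 3 cubicSeries
  let μ : TaylorIndex 3 3 := ⟨expo 0 0 3, by rw [degree_expo]⟩
  let ν : TaylorIndex 3 3 := ⟨expo 0 1 2, by rw [degree_expo]⟩
  have hcol : ∀ {x y z : ℕ} (h : 1 ≤ (expo x y z).degree ∧ (expo x y z).degree ≤ 2),
      D.col ⟨expo x y z, h⟩ (D.base b) = _ := fun {x y z} h =>
    (family_col_coeffVec _ constantCoeff_cubicSeries).trans
      (topPart_monomial_mul_cubicSeries (by rw [degree_expo] at h; exact h.2))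
  set S := Submodule.span ℂ (Set.range fun k => D.col k (D.base b))
  have hmem : ∀ {x y z : ℕ}, x + y + z = 3 → ¬(x = 0 ∧ y = 0) → ¬(x = 0 ∧ y = 1) →
      monoVec 3 x y z ∈ S := by
    refine fun {x y z} => mem_of_cubic_relations S (monoVec 3) (fun _ _ _ => monoVec_of_ne) ?_
    intro x y z h1 h2
    have h : 1 ≤ (expo x y z).degree ∧ (expo x y z).degree ≤ 2 := by
      rw [degree_expo]; exact ⟨h1, h2⟩
    rw [← hcol h]
    exact Submodule.subset_span ⟨_, rfl⟩
  have hnotμ : monoVec 3 0 0 3 ∉ S := by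
    -- Neither `x` nor `y ^ 2` divides `z ^ 3`; the same holds for `y z ^ 2`, used for `ν` below.
    have hle : S ≤ LinearMap.ker (LinearMap.proj μ : (TaylorIndex 3 3 → ℂ) →ₗ[ℂ] ℂ) := by
      refine Submodule.span_le.2 ?_
      rintro _ ⟨⟨k, hk⟩, rfl⟩
      obtain ⟨x, y, z, rfl⟩ := exists_eq_expo k
      simp only [hcol hk, SetLike.mem_coe, LinearMap.mem_ker, LinearMap.proj_apply, Pi.add_apply,
        monoVec_apply, μ, expo_inj]
      simp
    intro h
    have := LinearMap.mem_ker.1 (hle h)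
    simp [monoVec_apply, μ, degree_expo] at this
  have hnotν : monoVec 3 0 1 2 ∉ Submodule.span ℂ
      (insert (monoVec 3 0 0 3) (Set.range fun k => D.col k (D.base b))) := by
    have hle : Submodule.span ℂ
        (insert (monoVec 3 0 0 3) (Set.range fun k => D.col k (D.base b))) ≤
        LinearMap.ker (LinearMap.proj ν : (TaylorIndex 3 3 → ℂ) →ₗ[ℂ] ℂ) := by
      refine Submodule.span_le.2 (Set.insert_subset ?_ ?_)
      · simp [monoVec_apply, ν, expo_inj]
      · rintro _ ⟨⟨k, hk⟩, rfl⟩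
        obtain ⟨x, y, z, rfl⟩ := exists_eq_expo k
        simp only [hcol hk, SetLike.mem_coe, LinearMap.mem_ker, LinearMap.proj_apply, Pi.add_apply,
          monoVec_apply, ν, expo_inj]
        simp
    intro h
    have := LinearMap.mem_ker.1 (hle h)
    simp [monoVec_apply, ν, degree_expo] at this
  let G := ((Finset.univ.filter fun γ : TaylorIndex 3 3 => γ.1.degree = 3).erase μ).erase ν
  have hGcard : G.card = 8 := by
    rw [Finset.card_erase_of_mem (by simp [μ, ν, degree_expo, expo_inj]),
      Finset.card_erase_of_mem (by simp [μ, degree_expo]), card_filter_degree 3 3 (· = 3)]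
    rfl
  obtain ⟨K, hKG, hK, hrank⟩ := exists_linearIndepOn_col (a := 1) le_rfl (0 : Fin 3) b G
    (by
      rintro ⟨γ, hγ3⟩ hγ
      rw [Finset.mem_erase, Finset.mem_erase, Finset.mem_filter] at hγ
      obtain ⟨x, y, z, rfl⟩ := exists_eq_expo γ
      have h3 : x + y + z = 3 := by rw [← degree_expo]; exact hγ.2.2.2
      rw [← monoVec_eq_single h3]
      refine hmem h3 (fun h => hγ.2.1 (Subtype.ext (expo_inj.2 ?_)))
        (fun h => hγ.1 (Subtype.ext (expo_inj.2 ?_))) <;> omega)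
    (by rw [hGcard, card_posIndex]; rfl)
  exact D.codim_two ψ b K hK hrank (fun γ hγ => monoVec_of_degree_ne hγ)
    (fun γ hγ => monoVec_of_degree_ne hγ) hnotμ hnotν
    -- There are 9 free coefficients of degrees 1 and 2, and 9 + 8 = 17.
    (Finset.univ.filter fun γ : TaylorIndex 3 3 => 1 ≤ γ.1.degree ∧ γ.1.degree ≤ 2)
    (fun _ => middle_notMem) (n := 17)
    (by rw [card_filter_degree 3 3 fun j => 1 ≤ j ∧ j ≤ 2, hKG, hGcard]; rfl)
    (by rw [card_taylorIndex]; rfl)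

end TaylorIndex

end

theorem proposition4p1 :
    -- the first variety is expected to be a hypersurface, but has codimension two
    (topologicalKrullDim (ProjSpace (TaylorIndex 3 3)) = 19 ∧
      expectedDim 3 2 2 3 = 18 ∧
      topologicalKrullDim (taylorVariety 3 2 2 3) = 17) ∧
    -- the second and third are expected to fill their ambient space, but are hypersurfaces
    (topologicalKrullDim (ProjSpace (TaylorIndex 3 9)) = 219 ∧
      (expectedDim 3 8 5 9 = 219 ∧
        topologicalKrullDim (taylorVariety 3 8 5 9) = 218 ∧
        ProjSpace.IsHypersurface (taylorVariety 3 8 5 9)) ∧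
      (expectedDim 3 5 8 9 = 219 ∧
        topologicalKrullDim (taylorVariety 3 5 8 9) = 218 ∧
        ProjSpace.IsHypersurface (taylorVariety 3 5 8 9))) := by
  obtain ⟨h1, h2⟩ := TaylorIndex.family_3_2_2 (ChartInvolution.refl _)
  obtain ⟨h3, h4, h5⟩ := TaylorIndex.family_3_8_5 (ChartInvolution.refl _)
  obtain ⟨-, h6, h7⟩ := TaylorIndex.family_3_8_5 (TaylorIndex.inversion 3 9)
  refine ⟨⟨h1, rfl, ?_⟩, h3, ⟨rfl, ?_, ?_⟩, rfl, ?_, ?_⟩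
  · rw [TaylorIndex.taylorVariety_eq (d := 2)]
    exact h2
  · rw [TaylorIndex.taylorVariety_eq (d := 8)]
    exact h4
  · rw [TaylorIndex.taylorVariety_eq (d := 8)]
    exact h5
  · rw [TaylorIndex.taylorVariety_swap_eq (d := 8)]
    exact h6
  · rw [TaylorIndex.taylorVariety_swap_eq (d := 8)]
    exact h7
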